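/- Let $(M_0,P_0)\cong(\mathbb C^2,0)$ be a germ of smooth complex surface. A *cuspidal sequence* $\mathcal S$ over $(M_0,P_0)$ is a finite sequence of $N\ge 1$ point blowing-ups with centres $P_0,P_1,\dots,P_{N-1}$ such that each $P_k$ ($1\le k\le N-1$) lies on the divisor $E_k$ created by the blowing-up of $P_{k-1}$, and $e(P_{k-1})\le e(P_k)$ for $2\le k\le N-1$, where $e(P)\in\{1,2\}$ is the number of components of the total exceptional divisor through $P$; $P$ is *free* if $e(P)=1$ and a *corner* if $e(P)=2$. Let $f$ be the number of free points among $P_1,\dots,P_{N-1}$. The *Puiseux pair* $(n,m)$ of $\mathcal S$ is $(1,1)$ if $N=1$; if $N\geq 2$ and $(n_1,m_1)$ is the Puiseux pair of the sequence starting at $P_1$, it is $(n_1,n_1+m_1)$ if $f\ge 2$ and $(m_1,n_1+m_1)$ if $f=1$. Let $E$ be the last divisor of $\mathcal S$, let $\pi$ be the composition of the blowing-ups and $K=\pi^{-1}(P_0)$; assume $n\ge 2$. For a holomorphic $1$-form $\omega$ at $P_0$, the *divisorial order* $\nu_E(\omega)$ is the largest $\ell$ such that $u^{-\ell}\pi^*\omega$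 is a logarithmic $1$-form along $K$ at $Q$, where $Q$ is any point of $E$ and $u=0$ a reduced local equation of $E$ at $Q$. An *$E$-cusp* is a branch $\mathcal C$ at $P_0$ whose strict transform by $\pi$ is nonsingular and cuts $E$ transversely at a free point. If $\phi(t)$ is a reduced parametrization of $\mathcal C$ and $\phi^*\omega=a(t)\,\frac{dt}{t}$, the *differential value* is $\nu_{\mathcal C}(\omega)=\operatorname{ord}_t a(t)\in\mathbb N\cup\{\infty\}$; let $\Lambda$ be the set of finite differential values of holomorphic $1$-forms. Put $\Gamma=\{an+bm:\ a,b\in\mathbb Z_{\ge 0}\}$. A *basis* of $\Lambda$ is an increasing sequence $\lambda_{-1}<\lambda_0<\dots<\lambda_s$, $s\geq 0$, with $\Lambda=\Lambda_s$ and $\lambda_j\notin\Lambda_{j-1}$ for $0\le j\le s$, where $\Lambda_j=\bigcup_{i=-1}^{j}(\lambda_i+\Gamma)$. Define $u_i=\min(\Lambda_{i-2}\cap(\lambda_{i-1}+\Gamma))$ for $1\le i\le s+1$, and $t_{-1}=n$, $t_0=m$, $t_i=t_{i-1}+u_i-\lambda_{i-1}$ for $1\le i\le s+1$. A *standard basis*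 for $\mathcal C$ is a list $\omega_{-1},\omega_0,\dots,\omega_s$ of holomorphic $1$-forms at $P_0$ with $\nu_{\mathcal C}(\omega_i)=\lambda_i$ for all $i$. A holomorphic $1$-form $\omega$ is *dicritically adjusted* to $\mathcal C$ if $\nu_E(\omega)=t_{s+1}$ and $\nu_{\mathcal C}(\omega)=\infty$ (so that $\mathcal C$ is invariant by $\omega$). An *extended standard basis* is a list $\omega_{-1},\dots,\omega_s;\omega_{s+1}$ in which $\omega_{-1},\dots,\omega_s$ is a standard basis and $\omega_{s+1}$ is dicritically adjusted to $\mathcal C$. **Proposition.** For every $E$-cusp $\mathcal C$ the set $\Lambda$ has a basis, and for the basis $(\lambda_{-1},\dots,\lambda_s)$ of $\Lambda$ there is at least one $1$-form dicritically adjusted to $\mathcal C$. Consequently every standard basis $\omega_{-1},\dots,\omega_s$ for $\mathcal C$ can be completed by a $1$-form $\omega_{s+1}$ to an extended standard basis. -/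

import Mathlib

open Filter Topology

namespace CuspGeom

noncomputable section

/-! ### Point blowing-ups of a smooth surface germ, in local coordinates

The ambient germ is `(ℂ², 0)` with coordinates `(x, y)`.  The blow-up of a point with local
coordinates `(x, y)` has a projective line as exceptional divisor. -/

/-- A point of the exceptional line of the blow-up of a point with local coordinates `(x, y)`:
`fin c` is the direction of the line `y = c x`, and `inf` is the direction of `x = 0`. -/
inductive DirPoint where
  | fin (c : ℂ)
  | inf

/-- The blowing-up in coordinates `(x', y')` centred at a point of its exceptional divisor;
in both cases the exceptional divisor is `x' = 0`.
At `fin c`: `x = x'`, `y = x' (y' + c)`.  At `inf`: `x = x' y'`, `y = x'`. -/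
def blowChart : DirPoint → ℂ × ℂ → ℂ × ℂ
  | .fin c, p => (p.1, p.1 * (p.2 + c))
  | .inf, p => (p.1 * p.2, p.1)

/-- A sequence of blowing-ups in which each new centre lies on the last exceptional divisor
(a bamboo) is given by the list of its centres `P₁, P₂, …`, each one as a point of the
exceptional line of the blow-up of the preceding one (`P₀` is the origin).  This is the composition
of the blowing-ups in the coordinates centred at the last point of the list. -/
def composedChart : List DirPoint → ℂ × ℂ → ℂ × ℂ
  | [] => id
  | c :: cs => blowChart c ∘ composedChart cs

/-- Which of the coordinate axes `x = 0`, `y = 0` at a point are components of the total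
exceptional divisor, and how this changes in the centred coordinates after a blowing-up:
`x' = 0` is the new divisor, `y' = 0` is the strict transform of `y = 0` at `fin 0`
and the strict transform of `x = 0` at `inf`; at `fin c` with `c ≠ 0` the axis `y' = 0`
is not exceptional. -/
def nextAxes (K : Bool × Bool) : DirPoint → Bool × Bool
  | .fin c => (true, K.2 && @decide (c = 0) (Classical.propDecidable _))
  | .inf => (true, K.1)

/-- The exceptional axes at the last point of a list of infinitely near points. -/
def exceptionalAxes (cs : List DirPoint) : Bool × Bool :=
  cs.foldl nextAxes (false, false)

/-- The number `e(P)` of components of the total exceptional divisor through the last point `P`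
of the list.  The point is free if `e(P) = 1` and a corner if `e(P) = 2`. -/
def numComponents (cs : List DirPoint) : ℕ :=
  (exceptionalAxes cs).1.toNat + (exceptionalAxes cs).2.toNat

/-- A cuspidal sequence of `N` blowing-ups with centres `P₀ = 0, P₁, …, P_{N-1}`: a bamboo with
`e(P_{k-1}) ≤ e(P_k)` for `2 ≤ k ≤ N - 1`.  The list contains `P₁, …, P_{N-1}`. -/
structure CuspidalSequence where
  centers : List DirPoint
  cuspidal : ∀ k, 2 ≤ k → k ≤ centers.length →
    numComponents (centers.take (k - 1)) ≤ numComponents (centers.take k)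

/-- The index of freeness: the number of free points among `P₁, …, P_{N-1}`. -/
def freenessIndex (cs : List DirPoint) : ℕ :=
  ((Finset.Icc 1 cs.length).filter fun k => numComponents (cs.take k) = 1).card

/-- The Puiseux pair `(n, m)`, by induction on the number of blowing-ups: the tail of the list is
the sequence that starts at `P₁`. -/
def puiseuxPairAux : List DirPoint → ℕ × ℕ
  | [] => (1, 1)
  | c :: cs =>
    if 2 ≤ freenessIndex (c :: cs) then
      ((puiseuxPairAux cs).1, (puiseuxPairAux cs).2 + (puiseuxPairAux cs).1)
    else
      ((puiseuxPairAux cs).2, (puiseuxPairAux cs).1 + (puiseuxPairAux cs).2)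

/-- The Puiseux pair of a cuspidal sequence. -/
def CuspidalSequence.puiseuxPair (S : CuspidalSequence) : ℕ × ℕ := puiseuxPairAux S.centers

/-- The morphism `π` of the whole sequence, in coordinates `(u, v)` centred at the point `Q` of
the last divisor `E`; in these coordinates `E` is `u = 0`. -/
def CuspidalSequence.proj (S : CuspidalSequence) (Q : DirPoint) : ℂ × ℂ → ℂ × ℂ :=
  composedChart (S.centers ++ [Q])

/-- The point `Q` of the last divisor `E` is free: no other component passes through it. -/
def CuspidalSequence.IsFree (S : CuspidalSequence) (Q : DirPoint) : Prop :=
  numComponents (S.centers ++ [Q]) = 1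

/-! ### Holomorphic `1`-forms and the divisorial order -/

/-- Holomorphic `1`-forms at the origin of `ℂ²` (representatives of germs). -/
abbrev OneForm := {ω : ℂ × ℂ → (ℂ × ℂ →L[ℂ] ℂ) // AnalyticAt ℂ ω 0}

/-- Pull-back of a `1`-form. -/
def pullback (F : ℂ × ℂ → ℂ × ℂ) (ω : ℂ × ℂ → (ℂ × ℂ →L[ℂ] ℂ)) :
    ℂ × ℂ → (ℂ × ℂ →L[ℂ] ℂ) :=
  fun p => (ω (F p)).comp (fderiv ℂ F p)

/-- `u^{-ℓ} π^* ω` is a logarithmic `1`-form at the point `Q ∈ E` with respect to the total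
exceptional divisor: `π^* ω = u^ℓ (a du/u + b dv)` if `Q` is free and
`π^* ω = u^ℓ (a du/u + b dv/v)` if `Q` is a corner, with `a, b` holomorphic at `Q`. -/
def CuspidalSequence.LogDivisible (S : CuspidalSequence) (Q : DirPoint) (ω : OneForm) (ℓ : ℕ) :
    Prop :=
  ∃ a b : ℂ × ℂ → ℂ, AnalyticAt ℂ a 0 ∧ AnalyticAt ℂ b 0 ∧ ∀ᶠ p in 𝓝 (0 : ℂ × ℂ),
    p.1 * pullback (S.proj Q) ω.1 p (1, 0) = p.1 ^ ℓ * a p ∧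
    (S.IsFree Q → pullback (S.proj Q) ω.1 p (0, 1) = p.1 ^ ℓ * b p) ∧
    (¬ S.IsFree Q → p.2 * pullback (S.proj Q) ω.1 p (0, 1) = p.1 ^ ℓ * b p)

/-- The divisorial order of `ω` along `E`, computed at the point `Q ∈ E`: the largest `ℓ` such that
`u^{-ℓ} π^* ω` is logarithmic at `Q` (and `⊤` if there is no largest one). -/
def CuspidalSequence.divOrderAt (S : CuspidalSequence) (Q : DirPoint) (ω : OneForm) : ℕ∞ :=
  ⨆ (ℓ : ℕ) (_ : S.LogDivisible Q ω ℓ), (ℓ : ℕ∞)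

/-- `ν_E(ω) = d`, whatever point of `E` is used to compute the order. -/
def CuspidalSequence.HasDivOrder (S : CuspidalSequence) (ω : OneForm) (d : ℕ∞) : Prop :=
  ∀ Q : DirPoint, S.divOrderAt Q ω = d

/-! ### Branches, cusps and differential values -/

/-- An analytic branch at the origin of `ℂ²`, given by a reduced (that is, injective)
parametrization. -/
structure Branch where
  param : ℂ → ℂ × ℂ
  analytic : AnalyticAt ℂ param 0
  map_zero : param 0 = 0
  injective : ∃ U ∈ 𝓝 (0 : ℂ), Set.InjOn param U

/-- The branch is an `E`-cusp: its strict transform, parametrized by the lift `ψ`, is nonsingular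
and cuts `E = (u = 0)` transversely at a free point `Q`. -/
def Branch.IsCusp (C : Branch) (S : CuspidalSequence) : Prop :=
  ∃ Q : DirPoint, S.IsFree Q ∧ ∃ ψ : ℂ → ℂ × ℂ, AnalyticAt ℂ ψ 0 ∧ ψ 0 = 0 ∧
    (deriv ψ 0).1 ≠ 0 ∧ ∀ᶠ t in 𝓝 (0 : ℂ), C.param t = S.proj Q (ψ t)

/-- The differential value `ν_C(ω)`: the order of `a(t)`, where `φ^* ω = a(t) dt/t`. -/
def Branch.diffValue (C : Branch) (ω : OneForm) : ℕ∞ :=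
  analyticOrderAt (fun t : ℂ => t * ω.1 (C.param t) (deriv C.param t)) 0

/-- The set of (finite) differential values of a branch. -/
def Branch.diffValues (C : Branch) : Set ℕ :=
  {k | ∃ ω : OneForm, C.diffValue ω = k}

/-! ### Semimodules over the semigroup `Γ = ⟨n, m⟩`

A list `λ₋₁, λ₀, …, λₛ` is written as a sequence `lam` with the index shifted by one,
`lam i = λ_{i-1}`, of which only the terms with `i < s + 2` are used. -/

/-- The semigroup `Γ` generated by `n` and `m`. -/
def semigp (n m : ℕ) : Set ℕ := {k | ∃ a b : ℕ, k = a * n + b * m}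

/-- `λ + Γ`. -/
def translate (n m l : ℕ) : Set ℕ := {k | ∃ g ∈ semigp n m, k = l + g}

/-- The union of `lam i + Γ` for `i < j`; it is the semimodule `Λ_{j-2}`. -/
def gen (n m : ℕ) (lam : ℕ → ℕ) (j : ℕ) : Set ℕ := {k | ∃ i < j, k ∈ translate n m (lam i)}

/-- `(λ₋₁, …, λₛ)` is the basis of the semimodule `L`. -/
structure IsBasis (n m : ℕ) (L : Set ℕ) (s : ℕ) (lam : ℕ → ℕ) : Prop where
  increasing : ∀ i j, i < j → j < s + 2 → lam i < lam j
  not_mem : ∀ j, 1 ≤ j → j < s + 2 → lam j ∉ gen n m lam j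
  generates : L = gen n m lam (s + 2)

/-- The axis `u_i = min (Λ_{i-2} ∩ (λ_{i-1} + Γ))` for `1 ≤ i ≤ s + 1` (unshifted index). -/
def axisU (n m : ℕ) (lam : ℕ → ℕ) (i : ℕ) : ℕ :=
  sInf (gen n m lam i ∩ translate n m (lam i))

/-- The critical divisorial orders, with shifted index: `critOrder i = t_{i-1}`.  Thus `t₋₁ = n`,
`t₀ = m` and `t_i = t_{i-1} + u_i - λ_{i-1}` for `i ≥ 1`. -/
def critOrder (n m : ℕ) (lam : ℕ → ℕ) : ℕ → ℕ
  | 0 => n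
  | 1 => m
  | i + 2 => critOrder n m lam (i + 1) + axisU n m lam (i + 1) - lam (i + 1)

/-- `ω` is dicritically adjusted to `C`: `ν_E(ω) = t_{s+1}` and `ν_C(ω) = ∞`. -/
def IsDicriticallyAdjusted (S : CuspidalSequence) (C : Branch) (n m s : ℕ) (lam : ℕ → ℕ)
    (ω : OneForm) : Prop :=
  S.HasDivOrder ω (critOrder n m lam (s + 2)) ∧ C.diffValue ω = ⊤

/-- `W 0, …, W (s + 1)` (that is, `ω₋₁, …, ωₛ`) is a standard basis for `C`. -/
def IsStandardBasis (C : Branch) (s : ℕ) (lam : ℕ → ℕ) (W : ℕ → OneForm) : Prop :=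
  ∀ i < s + 2, C.diffValue (W i) = lam i

/-- `W 0, …, W (s + 1); W (s + 2)` (that is, `ω₋₁, …, ωₛ; ω_{s+1}`) is an extended standard
basis for `C`. -/
def IsExtendedStandardBasis (S : CuspidalSequence) (C : Branch) (n m s : ℕ) (lam : ℕ → ℕ)
    (W : ℕ → OneForm) : Prop :=
  IsStandardBasis C s lam W ∧ IsDicriticallyAdjusted S C n m s lam (W (s + 2))

end

end CuspGeom

namespace CuspGeom

/-! ### Arithmetic of the semigroup `⟨n, m⟩` -/

/-! Up to an automorphism of the ambient germ, π is monomial. Free points contribute only a shear y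
↦ y + P(x) and corners contribute monomial maps. In coordinates that do not depend on the point Q of
E, one gets x = u^n (v+e)^p, y = u^m (v+e)^q with nq − mp = ±1, and e ≠ 0 exactly when Q is free
(`CuspidalSequence.exists_coordinates`). In these coordinates x and y have orders n and m along the
cusp. Forms are filtered by the weight with x of weight n and y of weight m.

A weight below nm belongs to at most one monomial x^a y^b, so the forms of that weight are spanned
by x^a y^b dx/x and x^a y^b dy/y. The value on the cusp exceeds the weight only for multiples of the
resonant form x^a y^b (m dx/x − n dy/y). Hence a form whose value is a gap of Γ has a resonant
initial form (`CuspModel.initialDvd_base`).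

The critical orders are reached by induction. One carries a form η with initial form x^A y^B (m dx/x
− n dy/y), where nA + mB is the current critical order. Its value lies outside the semimodule
generated so far, and the initial form of η divides that of every form with a finite value outside
this semimodule. Subtracting multiples of η shows that its value is the least one outside
(`InitialDvd.val_le`), so it is the next λ. Multiply η by the monomial x^a₀ y^b₀ that brings its
value to the axis u, and cancel the leading coefficient against an earlier form with the same value
but larger weight. Then push the value out of the enlarged semimodule with forms of still larger
weight (`CuspModel.exists_reduction`). The initial form is now x^(A+a₀) y^(B+b₀) (m dx/x − n dy/y),
of weight equal to the next critical order. That divisibility persists is arithmetic: above the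
axis, the gaps of the semimodule fill a quadrant of pairs (p, q), and the quadrant moves with (A, B)
(`GapBox.step`).

The reduction stops because a function of high order on the cusp extends to the plane with a
prescribed power of x as a factor (`IsCurve.exists_extension`), so a large value can be made
infinite at once. After the last λ the value of η lies outside Λ, hence it is infinite. Its resonant
initial form pulls back to ±u^d (v+e)^k dv/(v+e) with d = t_{s+1}, which gives the divisorial order
exactly (`hasDivOrder_of_initial`). A basis exists by greedy choice, since Λ contains n + Γ and so
only finitely many values remain to be covered. -/

theorem weight_unique {n m a b c d : ℕ} (hco : Nat.Coprime n m) (hlt : n * a + m * b < n * m)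
    (h : n * a + m * b = n * c + m * d) : a = c ∧ b = d := by
  have hn : 0 < n := Nat.pos_of_ne_zero (by rintro rfl; simp at hlt)
  have hm : 0 < m := Nat.pos_of_ne_zero (by rintro rfl; simp at hlt)
  have hb : b < n := by
    by_contra hb
    have := Nat.mul_le_mul_left m (not_lt.1 hb)
    nlinarith
  have hd : d < n := by
    by_contra hd
    have := Nat.mul_le_mul_left m (not_lt.1 hd)
    nlinarith
  have hmod : m * b ≡ m * d [MOD n] := by
    have : n * a + m * b ≡ n * c + m * d [MOD n] := by rw [h]
    unfold Nat.ModEq at this ⊢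
    simpa [Nat.add_mod] using this
  have hbd : b = d := by
    have := Nat.ModEq.cancel_left_of_coprime hco hmod
    exact Nat.ModEq.eq_of_lt_of_lt this hb hd
  subst hbd
  exact ⟨Nat.eq_of_mul_eq_mul_left hn (by omega), rfl⟩

/-- A gap of the semigroup is of the form `n m - p n - q m` with `p, q ≥ 1`. -/
theorem gap_representation {n m k : ℕ} (hco : Nat.Coprime n m) (hn : 0 < n)
    (hk : k ∉ semigp n m) : ∃ p q, 1 ≤ p ∧ 1 ≤ q ∧ k + n * p + m * q = n * m := by
  -- With k + mq = nw and q ≤ n, the case w ≥ m would give k = n(w − m) + m(n − q) ∈ Γ; so p = m − w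
  -- ≥ 1.
  obtain ⟨q, hq1, hqn, hq⟩ : ∃ q, 1 ≤ q ∧ q ≤ n ∧ n ∣ k + m * q := by
    obtain ⟨z, hz, hmod⟩ := Nat.exists_mul_mod_eq_of_coprime k hco.symm hn.ne'
    refine ⟨n - z, by omega, by omega, ?_⟩
    have h1 : m * z + m * (n - z) = m * n := by rw [← mul_add]; congr 1; omega
    have h2 : k + m * (n - z) ≡ m * z + m * (n - z) [MOD n] := Nat.ModEq.add_right _ hmod.symm
    rw [h1] at h2
    exact (Nat.modEq_zero_iff_dvd).1 (h2.trans ((Nat.modEq_zero_iff_dvd).2 ⟨m, by ring⟩))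
  obtain ⟨w, hw⟩ := hq
  have hwm : w < m := by
    by_contra hwm
    obtain ⟨c, rfl⟩ := Nat.exists_eq_add_of_le (not_lt.1 hwm)
    obtain ⟨d, rfl⟩ := Nat.exists_eq_add_of_le hqn
    exact hk ⟨c, d, by nlinarith⟩
  obtain ⟨c, rfl⟩ := Nat.exists_eq_add_of_lt hwm
  exact ⟨c + 1, q, by omega, hq1, by nlinarith⟩

theorem gap_not_mem {n m k p q : ℕ} (hco : Nat.Coprime n m) (hn : 0 < n) (hp : 1 ≤ p)
    (hq : 1 ≤ q) (hk : k + n * p + m * q = n * m) : k ∉ semigp n m := by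
  rintro ⟨a, b, rfl⟩
  obtain ⟨p, rfl⟩ := Nat.exists_eq_add_of_le hp
  have hlt : n * (a + p) + m * (b + q) < n * m := by nlinarith
  have hq' : b + q < n := by
    by_contra h
    have := Nat.mul_le_mul_left m (not_lt.1 h)
    nlinarith
  have hdvd : n ∣ m * (b + q) := by
    have h1 : n ∣ n * m := ⟨m, rfl⟩
    rw [← hk] at h1
    have h2 : a * n + b * m + n * (1 + p) + m * q = n * (a + 1 + p) + m * (b + q) := by ring
    rw [h2] at h1
    exact (Nat.dvd_add_right ⟨_, rfl⟩).1 h1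
  have := Nat.le_of_dvd (by omega) (hco.dvd_of_dvd_mul_left hdvd)
  omega

theorem mem_translate {n m l k : ℕ} :
    k ∈ translate n m l ↔ ∃ a b, k = l + (n * a + m * b) := by
  constructor
  · rintro ⟨g, ⟨a, b, rfl⟩, rfl⟩
    exact ⟨a, b, by ring⟩
  · rintro ⟨a, b, rfl⟩
    exact ⟨a * n + b * m, ⟨a, b, rfl⟩, by ring⟩

theorem mem_gen {n m : ℕ} {lam : ℕ → ℕ} {j k : ℕ} :
    k ∈ gen n m lam j ↔ ∃ i < j, ∃ a b, k = lam i + (n * a + m * b) := by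
  simp only [gen, Set.mem_ofPred_eq, mem_translate]

theorem gen_succ {n m : ℕ} {lam : ℕ → ℕ} {j : ℕ} :
    gen n m lam (j + 1) = gen n m lam j ∪ translate n m (lam j) := by
  ext k
  simp only [gen, Set.mem_ofPred_eq, Set.mem_union]
  constructor
  · rintro ⟨i, hi, h⟩
    rcases Nat.lt_succ_iff_lt_or_eq.1 hi with h' | rfl
    · exact .inl ⟨i, h', h⟩
    · exact .inr h
  · rintro (⟨i, hi, h⟩ | h)
    · exact ⟨i, by omega, h⟩
    · exact ⟨j, by omega, h⟩

theorem gen_mono {n m : ℕ} {lam : ℕ → ℕ} {i j : ℕ} (h : i ≤ j) :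
    gen n m lam i ⊆ gen n m lam j :=
  fun _ ⟨l, hl, hk⟩ => ⟨l, hl.trans_le h, hk⟩

/-- Above `U`, the numbers outside `G` are the `n m - n p - m q` with `p ≥ A` and `q ≥ B`,
and no number of this form is in `G`. -/
structure GapBox (n m : ℕ) (G : Set ℕ) (U A B : ℕ) : Prop where
  one_le_left : 1 ≤ A
  one_le_right : 1 ≤ B
  not_mem : ∀ k p q, A ≤ p → B ≤ q → k + n * p + m * q = n * m → k ∉ G
  exists_eq : ∀ k, U < k → k ∉ G → ∃ p q, A ≤ p ∧ B ≤ q ∧ k + n * p + m * q = n * m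

/-- Adding na + mb to l lowers (p, q) to (p − a, q − b). Representations below nm are unique, so the
sum enters G exactly when this pair leaves the quadrant p ≥ A, q ≥ B. -/
theorem GapBox.mem_iff {n m : ℕ} {G : Set ℕ} {U A B l p q a b : ℕ} (hco : Nat.Coprime n m)
    (h : GapBox n m G U A B) (hl : U < l) (hlpq : l + n * p + m * q = n * m) :
    l + (n * a + m * b) ∈ G ↔ p < A + a ∨ q < B + b := by
  constructor
  · intro hG
    by_contra! hc
    obtain ⟨h1, h2⟩ := hc
    refine h.not_mem _ (p - a) (q - b) (by omega) (by omega) ?_ hG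
    obtain ⟨p', rfl⟩ := Nat.exists_eq_add_of_le (show a ≤ p by omega)
    obtain ⟨q', rfl⟩ := Nat.exists_eq_add_of_le (show b ≤ q by omega)
    simp only [Nat.add_sub_cancel_left]
    linarith
  · intro hc
    by_contra hG
    obtain ⟨p', q', hp', hq', he⟩ := h.exists_eq _ (by omega) hG
    have := weight_unique (a := p) (b := q) (c := p' + a) (d := q' + b) hco
      (by omega) (by linarith)
    omega

/-- Adding the generator `l` to `G`: the intersection of `G` with `l + Γ` has its minimum at a
multiple of `n` or at a multiple of `m`, and the box shrinks accordingly. -/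
theorem GapBox.step {n m : ℕ} {G : Set ℕ} {U A B l : ℕ} (hco : Nat.Coprime n m)
    (h : GapBox n m G U A B) (hl : U < l) (hlG : l ∉ G) :
    ∃ a₀ b₀, sInf (G ∩ translate n m l) = l + (n * a₀ + m * b₀) ∧
      l + (n * a₀ + m * b₀) ∈ G ∧
      GapBox n m (G ∪ translate n m l) (l + (n * a₀ + m * b₀)) (A + a₀) (B + b₀) ∧
      ∀ a b w, l + (n * a + m * b) ∈ G → l + (n * a + m * b) < w →
        w ∉ G ∪ translate n m l → a₀ ≤ a ∧ b₀ ≤ b := by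
  obtain ⟨p, q, hp, hq, hpq⟩ := h.exists_eq l hl hlG
  obtain ⟨x, rfl⟩ := Nat.exists_eq_add_of_le hp
  obtain ⟨y, rfl⟩ := Nat.exists_eq_add_of_le hq
  have hmem : ∀ a b, l + (n * a + m * b) ∈ G ↔ x < a ∨ y < b := fun a b => by
    rw [h.mem_iff hco hl hpq]; omega
  have hlow : ∀ a b, x < a ∨ y < b →
      n * (x + 1) ≤ n * a + m * b ∨ m * (y + 1) ≤ n * a + m * b := by
    rintro a b (h' | h')
    · exact .inl ((Nat.mul_le_mul_left n h').trans (Nat.le_add_right _ _))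
    · exact .inr ((Nat.mul_le_mul_left m h').trans (Nat.le_add_left _ _))
  have hout : ∀ k p' q', k + n * p' + m * q' = n * m → (A + x < p' ∨ B + y < q') →
      1 ≤ p' → 1 ≤ q' → k ∉ translate n m l := by
    intro k p' q' hk hc hp1 hq1 hkt
    obtain ⟨a, b, rfl⟩ := mem_translate.1 hkt
    have hlt : n * (A + x) + m * (B + y) < n * m ∨ l = 0 := by omega
    rcases hlt with hlt | rfl
    · have := weight_unique (c := p' + a) (d := q' + b) hco hlt (by linarith)
      omega
    · omega
  have hin : ∀ k p' q', k + n * p' + m * q' = n * m → p' ≤ A + x → q' ≤ B + y →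
      k ∈ translate n m l := by
    intro k p' q' hk hp' hq'
    obtain ⟨a, ha⟩ := Nat.exists_eq_add_of_le hp'
    obtain ⟨b, hb⟩ := Nat.exists_eq_add_of_le hq'
    rw [ha, hb] at hpq
    exact mem_translate.2 ⟨a, b, by linarith⟩
  -- By `hmem`, G ∩ (l + Γ) starts at l + n(x+1) or at l + m(y+1), whichever is smaller. The two
  -- cases are symmetric.
  rcases le_total (n * (x + 1)) (m * (y + 1)) with hle | hle
  · refine ⟨x + 1, 0, ?_, (hmem _ _).2 (by omega), ⟨?_, ?_, ?_, ?_⟩, ?_⟩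
    · apply le_antisymm
      · exact Nat.sInf_le ⟨(hmem _ _).2 (by omega), mem_translate.2 ⟨_, _, rfl⟩⟩
      · refine le_csInf ⟨_, (hmem (x + 1) 0).2 (by omega), mem_translate.2 ⟨_, _, rfl⟩⟩ ?_
        rintro k ⟨hkG, hkt⟩
        obtain ⟨a, b, rfl⟩ := mem_translate.1 hkt
        have := hlow a b ((hmem a b).1 hkG)
        simp only [mul_zero]
        omega
    · have := h.one_le_left; omega
    · have := h.one_le_right; omega
    · rintro k p' q' hp' hq' hk (hc | hc)
      · exact h.not_mem k p' q' (by omega) (by omega) hk hc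
      · exact hout k p' q' hk (by omega) (by omega) (by have := h.one_le_right; omega) hc
    · intro k hk hkG
      rw [Set.mem_union, not_or] at hkG
      obtain ⟨p', q', hp', hq', he⟩ := h.exists_eq k (by omega) hkG.1
      refine ⟨p', q', ?_, hq', he⟩
      by_contra hc
      -- If q' were smaller, k would lie in l + Γ. But with q' > B + y the number k is at most l +
      -- nx − m, below the axis.
      have hq2 : B + y < q' := by
        by_contra hc2
        exact hkG.2 (hin k p' q' he (by omega) (by omega))
      obtain ⟨c, rfl⟩ := Nat.exists_eq_add_of_lt hq2
      obtain ⟨d, rfl⟩ := Nat.exists_eq_add_of_le hp'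
      nlinarith
    · intro a b w hG hlt hw
      refine ⟨?_, Nat.zero_le _⟩
      by_contra hc
      have hyb : y < b := by have := (hmem a b).1 hG; omega
      rw [Set.mem_union, not_or] at hw
      obtain ⟨p', q', hp', hq', he⟩ := h.exists_eq w (by omega) hw.1
      have hyb' : m * (y + 1) ≤ m * b := Nat.mul_le_mul_left m hyb
      obtain ⟨c, rfl⟩ := Nat.exists_eq_add_of_le hp'
      obtain ⟨d, rfl⟩ := Nat.exists_eq_add_of_le hq'
      rcases lt_or_ge x c with h' | h'
      · have := Nat.mul_le_mul_left n h'
        nlinarith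
      · have hyd : y < d := by
          by_contra hc2
          exact hw.2 (hin w _ _ he (by omega) (by omega))
        have := Nat.mul_le_mul_left m hyd
        nlinarith
  · refine ⟨0, y + 1, ?_, (hmem _ _).2 (by omega), ⟨?_, ?_, ?_, ?_⟩, ?_⟩
    · apply le_antisymm
      · exact Nat.sInf_le ⟨(hmem _ _).2 (by omega), mem_translate.2 ⟨_, _, rfl⟩⟩
      · refine le_csInf ⟨_, (hmem 0 (y + 1)).2 (by omega), mem_translate.2 ⟨_, _, rfl⟩⟩ ?_
        rintro k ⟨hkG, hkt⟩
        obtain ⟨a, b, rfl⟩ := mem_translate.1 hkt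
        have := hlow a b ((hmem a b).1 hkG)
        simp only [mul_zero]
        omega
    · have := h.one_le_left; omega
    · have := h.one_le_right; omega
    · rintro k p' q' hp' hq' hk (hc | hc)
      · exact h.not_mem k p' q' (by omega) (by omega) hk hc
      · exact hout k p' q' hk (by omega) (by have := h.one_le_left; omega) (by omega) hc
    · intro k hk hkG
      rw [Set.mem_union, not_or] at hkG
      obtain ⟨p', q', hp', hq', he⟩ := h.exists_eq k (by omega) hkG.1
      refine ⟨p', q', hp', ?_, he⟩
      by_contra hc
      have hp2 : A + x < p' := by
        by_contra hc2
        exact hkG.2 (hin k p' q' he (by omega) (by omega))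
      obtain ⟨c, rfl⟩ := Nat.exists_eq_add_of_lt hp2
      obtain ⟨d, rfl⟩ := Nat.exists_eq_add_of_le hq'
      nlinarith
    · intro a b w hG hlt hw
      refine ⟨Nat.zero_le _, ?_⟩
      by_contra hc
      have hxa : x < a := by have := (hmem a b).1 hG; omega
      rw [Set.mem_union, not_or] at hw
      obtain ⟨p', q', hp', hq', he⟩ := h.exists_eq w (by omega) hw.1
      have hxa' : n * (x + 1) ≤ n * a := Nat.mul_le_mul_left n hxa
      obtain ⟨c, rfl⟩ := Nat.exists_eq_add_of_le hp'
      obtain ⟨d, rfl⟩ := Nat.exists_eq_add_of_le hq'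
      rcases lt_or_ge y d with h' | h'
      · have := Nat.mul_le_mul_left m h'
        nlinarith
      · have hxc : x < c := by
          by_contra hc2
          exact hw.2 (hin w _ _ he (by omega) (by omega))
        have := Nat.mul_le_mul_left n hxc
        nlinarith

end CuspGeom

namespace CuspGeom

/-! ### Filtered spaces of `1`-forms along a cusp

The algebraic properties of the space of `1`-forms, with its filtration by the weighted order and
its differential values, on which the construction of standard bases depends. -/

/-- A space `V` of forms with the multiplications `M a b` by the monomials `x ^ a y ^ b`, the
filtration `F` by the weighted order (`x` has weight `n` and `y` has weight `m`), the differential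
values `val`, the forms `dx`, `dy` and `θ = m y dx - n x dy`. -/
structure CuspModel (n m : ℕ) (V : Type*) [AddCommGroup V] [Module ℂ V] where
  M : ℕ → ℕ → V →ₗ[ℂ] V
  F : ℕ → Submodule ℂ V
  val : V → ℕ∞
  dx : V
  dy : V
  θ : V
  M_zero : ∀ v, M 0 0 v = v
  M_M : ∀ a b c d v, M a b (M c d v) = M (a + c) (b + d) v
  F_anti : Antitone F
  F_M : ∀ a b d v, v ∈ F d → M a b v ∈ F (d + (n * a + m * b))
  F_top : F n = ⊤
  val_add : ∀ v w, min (val v) (val w) ≤ val (v + w)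
  val_smul : ∀ (c : ℂ) v, c ≠ 0 → val (c • v) = val v
  val_cancel : ∀ (k : ℕ) v w, val v = k → val w = k → ∃ c : ℂ, c ≠ 0 ∧ k < val (v - c • w)
  val_M : ∀ a b v, val (M a b v) = val v + (n * a + m * b : ℕ)
  val_F : ∀ d v, v ∈ F d → d ≤ val v
  dx_mem : dx ∈ F n
  dy_mem : dy ∈ F m
  θ_mem : θ ∈ F (n + m)
  val_dx : val dx = n
  val_dy : val dy = m
  val_θ : (n + m : ℕ) < val θ
  graded : ∀ d v, d < n * m → v ∈ F d → v ∈ F (d + 1) ∨ val v = d ∧ d ∈ semigp n m ∨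
    ∃ (a b : ℕ) (c : ℂ), c ≠ 0 ∧ d = n * (a + 1) + m * (b + 1) ∧ v - c • M a b θ ∈ F (d + 1)
  completion : ∀ d, ∃ K : ℕ, ∀ v, K ≤ val v → ∃ w ∈ F d, val (v - w) = ⊤

namespace CuspModel

variable {n m : ℕ} {V : Type*} [AddCommGroup V] [Module ℂ V] (X : CuspModel n m V)

theorem val_sub (v w : V) : min (X.val v) (X.val w) ≤ X.val (v - w) := by
  have := X.val_add v ((-1 : ℂ) • w)
  rwa [X.val_smul _ _ (by norm_num), neg_one_smul, ← sub_eq_add_neg] at this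

theorem val_sub_eq_left {v w : V} (h : X.val v < X.val w) : X.val (v - w) = X.val v := by
  apply le_antisymm
  · by_contra! hc
    have := X.val_add (v - w) w
    rw [sub_add_cancel] at this
    exact absurd this (not_le.2 (lt_min hc h))
  · simpa [min_eq_left h.le] using X.val_sub v w

theorem val_sub_eq_right {v w : V} (h : X.val w < X.val v) : X.val (v - w) = X.val w := by
  have := X.val_sub_eq_left h
  rw [← this, ← X.val_smul (-1) (w - v) (by norm_num)]
  congr 1
  simp

/-- The set of finite values. -/
def values : Set ℕ := {k | ∃ v, X.val v = k}

theorem add_mem_values {k : ℕ} (hk : k ∈ X.values) (a b : ℕ) :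
    k + (n * a + m * b) ∈ X.values := by
  obtain ⟨v, hv⟩ := hk
  exact ⟨X.M a b v, by rw [X.val_M, hv]; norm_cast⟩

theorem val_ge (v : V) : n ≤ X.val v := X.val_F n v (by rw [X.F_top]; trivial)

/-- `v` has initial form `c x ^ a y ^ b (m dx / x - n dy / y)`. -/
def HasInitial (v : V) (c : ℂ) (a b : ℕ) : Prop :=
  1 ≤ a ∧ 1 ≤ b ∧ v - c • X.M (a - 1) (b - 1) X.θ ∈ X.F (n * a + m * b + 1)

/-- Every form with a finite value outside `G` has its initial form divisible by that of
`x ^ A y ^ B (m dx / x - n dy / y)`. -/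
def InitialDvd (G : Set ℕ) (A B : ℕ) : Prop :=
  ∀ (d k : ℕ) (v : V), v ∈ X.F d → X.val v = k → k ∉ G →
    ∃ (a b : ℕ) (c : ℂ), A ≤ a ∧ B ≤ b ∧ c ≠ 0 ∧ d ≤ n * a + m * b ∧ X.HasInitial v c a b

theorem HasInitial.mul {X : CuspModel n m V} {v : V} {c : ℂ} {a b : ℕ}
    (h : X.HasInitial v c a b) (e f : ℕ) :
    X.HasInitial (X.M e f v) c (e + a) (f + b) := by
  obtain ⟨h1, h2, h3⟩ := h
  refine ⟨by omega, by omega, ?_⟩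
  have h4 := X.F_M e f _ _ h3
  rw [map_sub, map_smul, X.M_M] at h4
  rw [Nat.add_sub_assoc h1, Nat.add_sub_assoc h2,
    show n * (e + a) + m * (f + b) + 1 = n * a + m * b + 1 + (n * e + m * f) by ring]
  exact h4

theorem HasInitial.sub_mem {X : CuspModel n m V} {v w : V} {c : ℂ} {a b : ℕ}
    (h : X.HasInitial v c a b) (hw : w ∈ X.F (n * a + m * b + 1)) :
    X.HasInitial (v - w) c a b := by
  refine ⟨h.1, h.2.1, ?_⟩
  rw [sub_right_comm]
  exact Submodule.sub_mem _ h.2.2 hw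

theorem HasInitial.sub_smul_mem {X : CuspModel n m V} {v w : V} {c : ℂ} {a b : ℕ}
    (h : X.HasInitial v c a b) (hw : X.HasInitial w 1 a b) :
    v - c • w ∈ X.F (n * a + m * b + 1) := by
  have := Submodule.sub_mem _ h.2.2 (Submodule.smul_mem _ c hw.2.2)
  rwa [smul_sub, one_smul, sub_sub_sub_cancel_right] at this

/-- Gaps of Γ are below nm, so `graded` applies at every weight up to k. The weight can be raised
until the initial form is resonant: a nonresonant one would make the value equal to the weight, an
element of Γ. Zero is removed from Γ to match the semimodule generated by n and m. -/
theorem initialDvd_base (hco : Nat.Coprime n m) (hn : 0 < n) :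
    X.InitialDvd {k | k ∈ semigp n m ∧ 0 < k} 1 1 := by
  intro d k v hd hv hk
  have hkn : n ≤ k := by have := X.val_ge v; rw [hv] at this; exact_mod_cast this
  have hk' : k ∉ semigp n m := fun h => hk ⟨h, by omega⟩
  obtain ⟨p, q, hp, hq, hpq⟩ := gap_representation hco hn hk'
  have hknm : k < n * m := by nlinarith
  obtain ⟨r, hr⟩ : ∃ r, r = k - d := ⟨_, rfl⟩
  induction r generalizing d with
  | zero =>
    have h1 : d ≤ k := by have := X.val_F d v hd; rw [hv] at this; exact_mod_cast this
    obtain rfl : d = k := by omega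
    rcases X.graded d v hknm hd with h | h | ⟨a, b, c, hc, hab, h⟩
    · have := X.val_F _ v h; rw [hv] at this; norm_cast at this; omega
    · exact absurd h.2 hk'
    · exact absurd ⟨a + 1, b + 1, by rw [hab]; ring⟩ hk'
  | succ r ih =>
    rcases X.graded d v (by omega) hd with h | h | ⟨a, b, c, hc, hab, h⟩
    · obtain ⟨a, b, c, h1, h2, h3, h4, h5⟩ := ih (d + 1) h (by omega)
      exact ⟨a, b, c, h1, h2, h3, by omega, h5⟩
    · have := h.1.symm.trans hv
      norm_cast at this
      omega
    · exact ⟨a + 1, b + 1, c, by omega, by omega, hc, hab.le, by omega, by omega,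
        by rw [← hab]; simpa using h⟩

/-- If `η` has the smallest possible initial form and its value is not in `G`, then it has the
smallest value among the forms whose value is not in `G`. -/
theorem InitialDvd.val_le {X : CuspModel n m V} {G : Set ℕ} {A B : ℕ} (h : X.InitialDvd G A B)
    {η : V} (hη : X.HasInitial η 1 A B) {d k : ℕ} {v : V} (hd : v ∈ X.F d) (hv : X.val v = k)
    (hk : k ∉ G) :
    ∃ (a b : ℕ) (c : ℂ), c ≠ 0 ∧ d ≤ n * (A + a) + m * (B + b) ∧
      X.HasInitial v c (A + a) (B + b) ∧ X.val η + (n * a + m * b : ℕ) ≤ k := by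
  obtain ⟨r, hr⟩ : ∃ r, r = k - d := ⟨_, rfl⟩
  induction r using Nat.strong_induction_on generalizing d v with
  | _ r ih =>
  obtain ⟨a', b', c, ha, hb, hc, hdab, hin⟩ := h d k v hd hv hk
  obtain ⟨a, rfl⟩ := Nat.exists_eq_add_of_le ha
  obtain ⟨b, rfl⟩ := Nat.exists_eq_add_of_le hb
  refine ⟨a, b, c, hc, hdab, hin, ?_⟩
  by_contra! hlt
  have h1 : X.HasInitial (X.M a b η) 1 (A + a) (B + b) := by
    rw [add_comm A, add_comm B]; exact hη.mul a b
  have h2 := hin.sub_smul_mem h1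
  -- If the multiple of η had the larger value, subtracting it would raise the weight of v and keep
  -- its value. The induction then yields a multiple of larger weight with value at most k, a
  -- contradiction.
  have h3 : X.val (v - c • X.M a b η) = k := by
    rw [X.val_sub_eq_left, hv]
    rwa [hv, X.val_smul _ _ hc, X.val_M]
  have h4 : n * (A + a) + m * (B + b) + 1 ≤ k := by
    have := X.val_F _ _ h2; rw [h3] at this; exact_mod_cast this
  obtain ⟨a₁, b₁, c₁, -, h5, -, h6⟩ := ih _ (by omega) h2 h3 rfl
  have h7 : n * a + m * b ≤ n * a₁ + m * b₁ := by nlinarith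
  have h8 : X.val η + (n * a + m * b : ℕ) ≤ X.val η + (n * a₁ + m * b₁ : ℕ) := by
    gcongr
  exact absurd (h8.trans h6) (not_le.2 hlt)

/-- Reduction of a form modulo forms of higher order: the value can be pushed out of `G`. -/
theorem exists_reduction {G : Set ℕ} {U d : ℕ}
    (hG : ∀ k ∈ G, U < k → ∃ w ∈ X.F d, X.val w = k) (v : V) (hv : U < X.val v) :
    ∃ w ∈ X.F d, U < X.val (v - w) ∧ ∀ k : ℕ, X.val (v - w) = k → k ∉ G := by
  obtain ⟨K, hK⟩ := X.completion d
  -- A value at least K is made infinite in one stroke by `completion`, so K bounds the number of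
  -- successive cancellations.
  by_cases hKv : K ≤ X.val v
  · obtain ⟨w, hw, h⟩ := hK v hKv
    exact ⟨w, hw, by rw [h]; exact ENat.natCast_lt_top _, fun k hk => by simp [h] at hk⟩
  have hfin : X.val v ≠ ⊤ := fun h => hKv (by simp [h])
  obtain ⟨k, hk⟩ := ENat.ne_top_iff_exists.1 hfin
  obtain ⟨r, hr⟩ : ∃ r, r = K - k := ⟨_, rfl⟩
  induction r using Nat.strong_induction_on generalizing v k with
  | _ r ih =>
  by_cases hkG : k ∈ G
  · rw [← hk] at hv hKv
    norm_cast at hv hKv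
    obtain ⟨w, hw, hwk⟩ := hG k hkG hv
    obtain ⟨c, hc, hlt⟩ := X.val_cancel k v w hk.symm hwk
    have hcw : c • w ∈ X.F d := Submodule.smul_mem _ _ hw
    have hlt' : U < X.val (v - c • w) := lt_trans (by exact_mod_cast hv) hlt
    by_cases hK' : K ≤ X.val (v - c • w)
    · obtain ⟨w', hw', h⟩ := hK _ hK'
      refine ⟨c • w + w', Submodule.add_mem _ hcw hw', ?_, fun k hk => ?_⟩
      · rw [← sub_sub, h]; exact ENat.natCast_lt_top _
      · rw [← sub_sub, h] at hk; simp at hk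
    · have hfin' : X.val (v - c • w) ≠ ⊤ := fun h => hK' (by simp [h])
      obtain ⟨k', hk'⟩ := ENat.ne_top_iff_exists.1 hfin'
      have hkk : k < k' := by rw [← hk'] at hlt; exact_mod_cast hlt
      obtain ⟨w', hw', h1, h2⟩ := ih (K - k') (by omega) (v - c • w) hlt' hK' hfin' k' hk' rfl
      refine ⟨c • w + w', Submodule.add_mem _ hcw hw', ?_, ?_⟩ <;> rw [← sub_sub]
      exacts [h1, h2]
  · exact ⟨0, Submodule.zero_mem _, by simpa using hv, fun k' hk' => by
      rw [sub_zero, ← hk] at hk'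
      norm_cast at hk'
      rwa [← hk']⟩

/-- One step of the construction of a standard basis: the situation after the first `j` elements
of the basis of values have been treated. -/
structure Stage (lam : ℕ → ℕ) (j U A B : ℕ) (η : V) : Prop where
  box : GapBox n m (gen n m lam j) U A B
  order : critOrder n m lam j = n * A + m * B
  initial : X.HasInitial η 1 A B
  val_not_mem : ∀ k : ℕ, X.val η = k → k ∉ gen n m lam j
  lt_val : U < X.val η
  dvd : X.InitialDvd (gen n m lam j) A B
  forms : ∀ i < j, lam i + critOrder n m lam j ≤ U + critOrder n m lam i ∧
    ∃ v ∈ X.F (critOrder n m lam i), X.val v = lam i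

/-- The bound says λ_i − t_i ≤ U − t, where t is the current critical order. Monomials raise value
and weight equally, so the excess of value over weight of each multiple is still at most U − t. -/
theorem exists_val_of_forms {lam : ℕ → ℕ} {j U : ℕ}
    (h : ∀ i < j, lam i + critOrder n m lam j ≤ U + critOrder n m lam i ∧
      ∃ v ∈ X.F (critOrder n m lam i), X.val v = lam i) {k : ℕ} (hk : k ∈ gen n m lam j)
    (hU : U < k) : ∃ w ∈ X.F (critOrder n m lam j + (k - U)), X.val w = k := by
  obtain ⟨i, hi, a, b, rfl⟩ := mem_gen.1 hk
  obtain ⟨h1, v, hv, hvk⟩ := h i hi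
  refine ⟨X.M a b v, X.F_anti (by omega) (X.F_M a b _ _ hv), ?_⟩
  rw [X.val_M, hvk]
  norm_cast

/-- The new U is the axis l + n a₀ + m b₀ with l = λ, and (A, B) moves by (a₀, b₀). Every correction
to x^a₀ y^b₀ η has weight above the new critical order, so the initial form survives. -/
theorem Stage.step {X : CuspModel n m V} {lam : ℕ → ℕ} {j U A B : ℕ} {η : V}
    (hco : Nat.Coprime n m) (hj : 2 ≤ j) (h : X.Stage lam j U A B η) (hη : X.val η = lam j) :
    ∃ U' A' B' η', X.Stage lam (j + 1) U' A' B' η' := by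
  have hU : U < lam j := by have := h.lt_val; rw [hη] at this; exact_mod_cast this
  obtain ⟨a₀, b₀, hinf, hmem, hbox, hdiv⟩ := h.box.step hco hU (h.val_not_mem _ hη)
  rw [← gen_succ] at hbox hdiv
  set U' := lam j + (n * a₀ + m * b₀) with hU'
  have hcrit : critOrder n m lam (j + 1) = n * (A + a₀) + m * (B + b₀) := by
    obtain ⟨i, rfl⟩ : ∃ i, j = i + 1 := ⟨j - 1, by omega⟩
    have : critOrder n m lam (i + 1 + 1) =
      critOrder n m lam (i + 1) + axisU n m lam (i + 1) - lam (i + 1) := rfl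
    rw [this, h.order, axisU, hinf, hU', mul_add, mul_add]
    omega
  have horder := h.order
  rw [mul_add, mul_add] at hcrit
  have hforms : ∀ i < j + 1,
      lam i + critOrder n m lam (j + 1) ≤ U' + critOrder n m lam i ∧
      ∃ v ∈ X.F (critOrder n m lam i), X.val v = lam i := by
    intro i hi
    rcases Nat.lt_succ_iff_lt_or_eq.1 hi with hi | rfl
    · have := (h.forms i hi).1
      exact ⟨by omega, (h.forms i hi).2⟩
    · refine ⟨by omega, η, ?_, hη⟩
      have h1 := h.initial.2.2
      have h2 : X.M (A - 1) (B - 1) X.θ ∈ X.F (n * A + m * B) := by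
        have := X.F_M (A - 1) (B - 1) _ _ X.θ_mem
        convert this using 2
        obtain ⟨A, rfl⟩ := Nat.exists_eq_add_of_le h.initial.1
        obtain ⟨B, rfl⟩ := Nat.exists_eq_add_of_le h.initial.2.1
        simp only [Nat.add_sub_cancel_left]
        ring
      rw [one_smul] at h1
      have := Submodule.add_mem _ (X.F_anti (Nat.le_succ _) h1) h2
      rwa [sub_add_cancel, ← horder] at this
  have hvalξ₀ : X.val (X.M a₀ b₀ η) = U' := by
    rw [X.val_M, hη, hU']
    norm_cast
  -- The axis also lies in the earlier semimodule. Since λ > U, the form realizing it there has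
  -- weight strictly above that of x^a₀ y^b₀ η.
  obtain ⟨w, hw, hwval⟩ := X.exists_val_of_forms h.forms hmem (by omega)
  obtain ⟨c, hc, hlt⟩ := X.val_cancel U' _ w hvalξ₀ (by rw [hwval])
  have hin₀ : X.HasInitial (X.M a₀ b₀ η) 1 (A + a₀) (B + b₀) := by
    rw [add_comm A, add_comm B]; exact h.initial.mul a₀ b₀
  have hin : X.HasInitial (X.M a₀ b₀ η - c • w) 1 (A + a₀) (B + b₀) := by
    refine hin₀.sub_mem (Submodule.smul_mem _ _ (X.F_anti ?_ hw))
    rw [mul_add, mul_add]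
    omega
  obtain ⟨w', hw', hval', hnot⟩ := X.exists_reduction (G := gen n m lam (j + 1)) (U := U')
    (d := critOrder n m lam (j + 1) + 1) (fun k hk hUk => by
      obtain ⟨w, hw, hwk⟩ := X.exists_val_of_forms hforms hk hUk
      exact ⟨w, X.F_anti (by omega) hw, hwk⟩) (X.M a₀ b₀ η - c • w) hlt
  refine ⟨U', A + a₀, B + b₀, _, hbox, by rw [hcrit]; ring, hin.sub_mem ?_, hnot, hval', ?_,
    hforms⟩
  · rw [hcrit] at hw'
    rwa [mul_add, mul_add]
  · intro d k v hd hv hk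
    have hkj : k ∉ gen n m lam j := fun hc => hk (gen_mono (Nat.le_succ j) hc)
    obtain ⟨a, b, c, hc, hdab, hin, hle⟩ := h.dvd.val_le h.initial hd hv hkj
    rw [hη] at hle
    norm_cast at hle
    have hne : lam j + (n * a + m * b) ≠ k := fun he => hk (mem_gen.2 ⟨j, by omega, a, b, he.symm⟩)
    have hin' : X.HasInitial (X.M a b η) 1 (A + a) (B + b) := by
      rw [add_comm A, add_comm B]; exact h.initial.mul a b
    have h2 := hin.sub_smul_mem hin'
    have h3 : X.val (v - c • X.M a b η) = (lam j + (n * a + m * b) : ℕ) := by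
      have h4 : X.val (c • X.M a b η) = (lam j + (n * a + m * b) : ℕ) := by
        rw [X.val_smul _ _ hc, X.val_M, hη]
        norm_cast
      rw [X.val_sub_eq_right, h4]
      rw [h4, hv]
      exact_mod_cast lt_of_le_of_ne hle hne
    -- Subtracting the matching multiple of η from v leaves a form of larger weight with this value.
    -- Were the value outside the old semimodule, the minimality of η would force it to be larger.
    -- So it lies inside, and `hdiv` applies because k is a gap of the new semimodule above it.
    have hG : lam j + (n * a + m * b) ∈ gen n m lam j := by
      by_contra hG
      obtain ⟨a₁, b₁, c₁, -, h5, -, h6⟩ := h.dvd.val_le h.initial h2 h3 hG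
      rw [hη] at h6
      norm_cast at h6
      nlinarith
    obtain ⟨h7, h8⟩ := hdiv a b k hG (lt_of_le_of_ne hle hne) hk
    exact ⟨A + a, B + b, c, by omega, by omega, hc, hdab, hin⟩

/-! ### The basis of the set of values, its first two elements, and the dicritical form. -/

theorem values_lower_bound {L : Set ℕ} {s : ℕ} {lam : ℕ → ℕ} (h : IsBasis n m L s lam) {j k : ℕ}
    (hk : k ∈ L) (hkj : k ∉ gen n m lam j) : lam j ≤ k := by
  rw [h.generates] at hk
  obtain ⟨i, hi, a, b, rfl⟩ := mem_gen.1 hk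
  have hij : j ≤ i := by
    by_contra hij
    exact hkj (mem_gen.2 ⟨i, by omega, a, b, rfl⟩)
  rcases hij.lt_or_eq with hij | rfl
  · have := h.increasing j i hij hi
    omega
  · omega

theorem lam_mem {L : Set ℕ} {s : ℕ} {lam : ℕ → ℕ} (h : IsBasis n m L s lam) {j : ℕ}
    (hj : j < s + 2) : lam j ∈ L := by
  rw [h.generates]
  exact mem_gen.2 ⟨j, hj, 0, 0, by simp⟩

theorem dx_value : n ∈ X.values := ⟨X.dx, X.val_dx⟩

theorem dy_value : m ∈ X.values := ⟨X.dy, X.val_dy⟩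

theorem le_of_mem_values {k : ℕ} (hk : k ∈ X.values) : n ≤ k := by
  obtain ⟨v, hv⟩ := hk
  have := X.val_ge v
  rw [hv] at this
  exact_mod_cast this

theorem basis_zero {s : ℕ} {lam : ℕ → ℕ} (h : IsBasis n m X.values s lam) : lam 0 = n :=
  le_antisymm (values_lower_bound h X.dx_value (by rw [mem_gen]; simp))
    (X.le_of_mem_values (lam_mem h (by omega)))

theorem basis_one {s : ℕ} {lam : ℕ → ℕ} (hco : Nat.Coprime n m) (hn : 2 ≤ n)
    (h : IsBasis n m X.values s lam) : lam 1 = m := by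
  have h0 := X.basis_zero h
  apply le_antisymm
  · refine values_lower_bound h X.dy_value ?_
    rw [mem_gen]
    rintro ⟨i, hi, a, b, hab⟩
    obtain rfl : i = 0 := by omega
    rw [h0] at hab
    obtain rfl : b = 0 := by
      by_contra hb
      have := Nat.mul_le_mul_left m (Nat.one_le_iff_ne_zero.2 hb)
      omega
    have : n ∣ m := ⟨a + 1, by rw [hab]; ring⟩
    have := Nat.Coprime.eq_one_of_dvd hco this
    omega
  -- A value below m outside n + Γ is not in Γ, so its form has a resonant initial form, of weight
  -- at least n + m > m.
  · by_contra! hlt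
    obtain ⟨v, hv⟩ := lam_mem h (j := 1) (by omega)
    have hnot : lam 1 ∉ {k | k ∈ semigp n m ∧ 0 < k} := by
      rintro ⟨⟨a, b, hab⟩, hpos⟩
      obtain rfl : b = 0 := by
        by_contra hb
        have := Nat.mul_le_mul_right m (Nat.one_le_iff_ne_zero.2 hb)
        omega
      refine h.not_mem 1 le_rfl (by omega) (mem_gen.2 ⟨0, by omega, a - 1, 0, ?_⟩)
      obtain ⟨a, rfl⟩ : ∃ a', a = a' + 1 := ⟨a - 1, by
        have : a ≠ 0 := by rintro rfl; omega
        omega⟩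
      rw [h0, hab, Nat.add_sub_cancel]
      ring
    obtain ⟨a, b, c, ha, hb, hc, hd, hin⟩ := X.initialDvd_base hco (by omega) n (lam 1) v
      (by rw [X.F_top]; trivial) hv hnot
    have hmem : v ∈ X.F (n * a + m * b) := by
      have h1 := X.F_anti (Nat.le_succ _) hin.2.2
      have h2 := X.F_M (a - 1) (b - 1) _ _ X.θ_mem
      have h3 : n + m + (n * (a - 1) + m * (b - 1)) = n * a + m * b := by
        obtain ⟨a, rfl⟩ := Nat.exists_eq_add_of_le ha
        obtain ⟨b, rfl⟩ := Nat.exists_eq_add_of_le hb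
        simp only [Nat.add_sub_cancel_left]
        ring
      rw [h3] at h2
      have := Submodule.add_mem _ h1 (Submodule.smul_mem _ c h2)
      rwa [sub_add_cancel] at this
    have := X.val_F _ _ hmem
    rw [hv] at this
    norm_cast at this
    nlinarith

theorem gen_two {lam : ℕ → ℕ} (hn : 0 < n) (hm : 0 < m) (h0 : lam 0 = n) (h1 : lam 1 = m) :
    gen n m lam 2 = {k | k ∈ semigp n m ∧ 0 < k} := by
  ext k
  rw [mem_gen]
  constructor
  · rintro ⟨i, hi, a, b, rfl⟩
    obtain rfl | rfl : i = 0 ∨ i = 1 := by omega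
    · exact ⟨⟨a + 1, b, by rw [h0]; ring⟩, by omega⟩
    · exact ⟨⟨a, b + 1, by rw [h1]; ring⟩, by omega⟩
  · rintro ⟨⟨a, b, rfl⟩, hpos⟩
    rcases a with _ | a
    · rcases b with _ | b
      · simp at hpos
      · exact ⟨1, by omega, 0, b, by rw [h1]; ring⟩
    · exact ⟨0, by omega, a, b, by rw [h0]; ring⟩

theorem axisU_one {lam : ℕ → ℕ} (hco : Nat.Coprime n m) (hn : 2 ≤ n) (hnm : n < m)
    (h0 : lam 0 = n) (h1 : lam 1 = m) : axisU n m lam 1 = n + m := by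
  have hmem : n + m ∈ gen n m lam 1 ∩ translate n m (lam 1) :=
    ⟨mem_gen.2 ⟨0, by omega, 0, 1, by rw [h0]; ring⟩,
      mem_translate.2 ⟨1, 0, by rw [h1]; ring⟩⟩
  apply le_antisymm (Nat.sInf_le hmem)
  refine le_csInf ⟨_, hmem⟩ ?_
  rintro k ⟨hk1, hk2⟩
  obtain ⟨i, hi, a, b, rfl⟩ := mem_gen.1 hk1
  obtain rfl : i = 0 := by omega
  obtain ⟨c, d, hcd⟩ := mem_translate.1 hk2
  rw [h0, h1] at hcd
  rw [h0]
  by_contra! hlt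
  have hb : b = 0 := by
    by_contra hb
    have := Nat.mul_le_mul_left m (Nat.one_le_iff_ne_zero.2 hb)
    omega
  have hc : c = 0 := by
    by_contra hc
    have := Nat.mul_le_mul_left n (Nat.one_le_iff_ne_zero.2 hc)
    omega
  have hd : d = 0 := by
    by_contra hd
    have := Nat.mul_le_mul_left m (Nat.one_le_iff_ne_zero.2 hd)
    omega
  subst hb hc hd
  have : n ∣ m := ⟨a + 1, by linarith⟩
  have := Nat.Coprime.eq_one_of_dvd hco this
  omega

/-- The induction starts from m y dx − n x dy, whose value exceeds its weight n + m = u_1 = t_1; the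
gaps are those of Γ, so A = B = 1. -/
theorem exists_stage_two {s : ℕ} {lam : ℕ → ℕ} (hco : Nat.Coprime n m) (hn : 2 ≤ n)
    (hnm : n < m) (h : IsBasis n m X.values s lam) :
    ∃ U A B η, X.Stage lam 2 U A B η := by
  have h0 := X.basis_zero h
  have h1 := X.basis_one hco hn h
  have hgen := gen_two (lam := lam) (by omega) (by omega) h0 h1
  have hcrit : critOrder n m lam 2 = n + m := by
    have : critOrder n m lam 2 = m + axisU n m lam 1 - lam 1 := rfl
    rw [this, axisU_one hco hn hnm h0 h1, h1]
    omega
  have hforms : ∀ i < 2, lam i + critOrder n m lam 2 ≤ n + m + critOrder n m lam i ∧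
      ∃ v ∈ X.F (critOrder n m lam i), X.val v = lam i := by
    intro i hi
    obtain rfl | rfl : i = 0 ∨ i = 1 := by omega
    · exact ⟨by rw [hcrit, h0]; simp only [critOrder]; omega, X.dx, X.dx_mem, by
        rw [h0, X.val_dx]⟩
    · exact ⟨by rw [hcrit, h1]; simp only [critOrder]; omega, X.dy, X.dy_mem, by
        rw [h1, X.val_dy]⟩
  obtain ⟨w, hw, hval, hnot⟩ := X.exists_reduction (G := gen n m lam 2) (U := n + m)
    (d := n + m + 1) (fun k hk hUk => by
      obtain ⟨w, hw, hwk⟩ := X.exists_val_of_forms hforms hk hUk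
      exact ⟨w, X.F_anti (by omega) hw, hwk⟩) X.θ X.val_θ
  refine ⟨n + m, 1, 1, X.θ - w, ⟨le_rfl, le_rfl, ?_, ?_⟩, by rw [hcrit]; ring,
    ⟨le_rfl, le_rfl, ?_⟩, hnot, hval, ?_, hforms⟩
  · intro k p q hp hq hk hkG
    rw [hgen] at hkG
    exact gap_not_mem hco (by omega) hp hq hk hkG.1
  · intro k hk hkG
    rw [hgen] at hkG
    exact gap_representation hco (by omega) fun hc => hkG ⟨hc, by omega⟩
  · have h2 := Submodule.neg_mem _ hw
    simpa [X.M_zero] using h2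
  · rw [hgen]
    exact X.initialDvd_base hco (by omega)

theorem exists_stage {s : ℕ} {lam : ℕ → ℕ} (hco : Nat.Coprime n m) (hn : 2 ≤ n)
    (hnm : n < m) (h : IsBasis n m X.values s lam) (i : ℕ) (hi : i ≤ s) :
    ∃ U A B η, X.Stage lam (i + 2) U A B η := by
  induction i with
  | zero => exact X.exists_stage_two hco hn hnm h
  | succ i ih =>
    obtain ⟨U, A, B, η, hst⟩ := ih (by omega)
    refine hst.step hco (by omega) ?_
    obtain ⟨v, hv⟩ := lam_mem h (j := i + 2) (by omega)
    -- The value of η bounds λ from below by `val_le`. It is itself a value outside the semimodule,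
    -- so minimality of λ gives equality.
    obtain ⟨a, b, c, -, -, -, hle⟩ := hst.dvd.val_le hst.initial
      (d := n) (by rw [X.F_top]; trivial) hv (h.not_mem _ (by omega) (by omega))
    have hle' : X.val η ≤ lam (i + 2) := le_trans le_self_add hle
    obtain ⟨k, hk⟩ := ENat.ne_top_iff_exists.1 (ne_top_of_le_ne_top (ENat.natCast_ne_top _) hle')
    have := values_lower_bound h (j := i + 2) ⟨η, hk.symm⟩ (hst.val_not_mem k hk.symm)
    rw [← hk] at hle' ⊢
    norm_cast at hle' ⊢
    omega

/-- There is a form with infinite value whose initial form has weight `t_{s+1}`. -/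
theorem exists_dicritical {s : ℕ} {lam : ℕ → ℕ} (hco : Nat.Coprime n m) (hn : 2 ≤ n)
    (hnm : n < m) (h : IsBasis n m X.values s lam) :
    ∃ (A B : ℕ) (η : V), critOrder n m lam (s + 2) = n * A + m * B ∧ X.val η = ⊤ ∧
      X.HasInitial η 1 A B := by
  obtain ⟨U, A, B, η, hst⟩ := X.exists_stage hco hn hnm h s le_rfl
  refine ⟨A, B, η, hst.order, ?_, hst.initial⟩
  by_contra hfin
  obtain ⟨k, hk⟩ := ENat.ne_top_iff_exists.1 hfin
  refine hst.val_not_mem k hk.symm ?_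
  rw [← h.generates]
  exact ⟨η, hk.symm⟩

end CuspModel

end CuspGeom

namespace CuspGeom

/-! ### Existence of bases -/

theorem gen_congr {n m : ℕ} {lam lam' : ℕ → ℕ} {j : ℕ} (h : ∀ i < j, lam i = lam' i) :
    gen n m lam j = gen n m lam' j := by
  ext k
  rw [mem_gen, mem_gen]
  constructor <;> rintro ⟨i, hi, a, b, rfl⟩
  exacts [⟨i, hi, a, b, by rw [h i hi]⟩, ⟨i, hi, a, b, by rw [h i hi]⟩]

/-- The first `j ≥ 1` elements of the basis of a semimodule `L` with minimum `n`. -/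
structure PartialBasis (n m : ℕ) (L : Set ℕ) (j : ℕ) (lam : ℕ → ℕ) : Prop where
  one_le : 1 ≤ j
  zero : lam 0 = n
  increasing : ∀ i k, i < k → k < j → lam i < lam k
  not_mem : ∀ i, 1 ≤ i → i < j → lam i ∉ gen n m lam i
  subset : gen n m lam j ⊆ L
  lt_of_not_mem : ∀ k ∈ L, k ∉ gen n m lam j → ∀ i < j, lam i < k

theorem PartialBasis.extend {n m : ℕ} {L : Set ℕ} {j : ℕ} {lam : ℕ → ℕ}
    (hL : ∀ k ∈ L, ∀ a b, k + (n * a + m * b) ∈ L) (h : PartialBasis n m L j lam) {l : ℕ}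
    (hl : l ∈ L) (hlj : l ∉ gen n m lam j) (hmin : ∀ k ∈ L, k ∉ gen n m lam j → l ≤ k) :
    PartialBasis n m L (j + 1) (Function.update lam j l) := by
  have hj := h.one_le
  have hne : ∀ i < j, Function.update lam j l i = lam i := fun i hi => by
    rw [Function.update_of_ne (by omega)]
  have hself : Function.update lam j l j = l := Function.update_self ..
  have hg : ∀ i ≤ j, gen n m (Function.update lam j l) i = gen n m lam i := fun i hi =>
    gen_congr fun k hk => hne k (by omega)
  have hgs : gen n m (Function.update lam j l) (j + 1) = gen n m lam j ∪ translate n m l := by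
    rw [gen_succ, hg j le_rfl, hself]
  refine ⟨by omega, by rw [hne 0 (by omega), h.zero], ?_, ?_, ?_, ?_⟩
  · intro i k hik hk
    rcases Nat.lt_succ_iff_lt_or_eq.1 hk with hk | rfl
    · rw [hne i (by omega), hne k hk]
      exact h.increasing i k hik hk
    · rw [hself, hne i hik]
      exact h.lt_of_not_mem l hl hlj i hik
  · intro i h1 hi
    rw [hg i (by omega)]
    rcases Nat.lt_succ_iff_lt_or_eq.1 hi with hi | rfl
    · rw [hne i hi]
      exact h.not_mem i h1 hi
    · rwa [hself]
  · rw [hgs]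
    rintro k (hk | hk)
    · exact h.subset hk
    · obtain ⟨a, b, rfl⟩ := mem_translate.1 hk
      exact hL l hl a b
  · rw [hgs]
    intro k hk hkj i hi
    rw [Set.mem_union, not_or] at hkj
    rcases Nat.lt_succ_iff_lt_or_eq.1 hi with hi | rfl
    · rw [hne i hi]
      exact h.lt_of_not_mem k hk hkj.1 i hi
    · rw [hself]
      refine lt_of_le_of_ne (hmin k hk hkj.1) ?_
      rintro rfl
      exact hkj.2 (mem_translate.2 ⟨0, 0, by simp⟩)

/-- Adjoin the least missing element repeatedly; each step strictly shrinks the finite set still to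
be covered. -/
theorem PartialBasis.exists_complete {n m : ℕ} {L : Set ℕ} (hco : Nat.Coprime n m) (hn : 0 < n)
    (hL : ∀ k ∈ L, ∀ a b, k + (n * a + m * b) ∈ L) {j : ℕ} {lam : ℕ → ℕ}
    (h : PartialBasis n m L j lam) :
    ∃ j' lam', PartialBasis n m L j' lam' ∧ L ⊆ gen n m lam' j' := by
  by_cases hc : L ⊆ gen n m lam j
  · exact ⟨j, lam, h, hc⟩
  have hfin : ∀ j lam, PartialBasis n m L j lam → (L \ gen n m lam j).Finite := by
    intro j lam h
    -- Every number at least nm lies in Γ, so n + Γ contains everything from nm + n on.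
    refine (Set.finite_Iio (n * m + n)).subset fun k hk => ?_
    by_contra hge
    rw [Set.mem_Iio, not_lt] at hge
    have hmem : k - n ∈ semigp n m := by
      by_contra hgap
      obtain ⟨p, q, hp, hq, hpq⟩ := gap_representation hco hn hgap
      have : n * 1 ≤ n * p := Nat.mul_le_mul_left n hp
      omega
    obtain ⟨a, b, hab⟩ := hmem
    refine hk.2 (mem_gen.2 ⟨0, h.one_le, a, b, ?_⟩)
    rw [h.zero, mul_comm n a, mul_comm m b, ← hab]
    omega
  obtain ⟨r, hr⟩ : ∃ r, r = (L \ gen n m lam j).ncard := ⟨_, rfl⟩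
  induction r using Nat.strong_induction_on generalizing j lam with
  | _ r ih =>
  have hne : (L \ gen n m lam j).Nonempty := Set.sdiff_nonempty.2 hc
  have hl := Nat.sInf_mem hne
  have h' := h.extend hL hl.1 hl.2 fun k hk hk' => Nat.sInf_le ⟨hk, hk'⟩
  by_cases hc' : L ⊆ gen n m (Function.update lam j (sInf (L \ gen n m lam j))) (j + 1)
  · exact ⟨_, _, h', hc'⟩
  refine ih _ ?_ h' hc' rfl
  rw [hr]
  refine Set.ncard_lt_ncard ?_ (hfin _ _ h)
  have hg : gen n m (Function.update lam j (sInf (L \ gen n m lam j))) (j + 1) =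
      gen n m lam j ∪ translate n m (sInf (L \ gen n m lam j)) := by
    rw [gen_succ, Function.update_self]
    congr 1
    exact gen_congr fun i hi => by rw [Function.update_of_ne (by omega)]
  rw [hg]
  refine ⟨fun k hk => ⟨hk.1, fun hk' => hk.2 (.inl hk')⟩, fun hsub => ?_⟩
  exact (hsub hl).2 (.inr (mem_translate.2 ⟨0, 0, by simp⟩))

theorem CuspModel.exists_basis {n m : ℕ} {V : Type*} [AddCommGroup V] [Module ℂ V]
    (X : CuspModel n m V) (hco : Nat.Coprime n m) (hn : 2 ≤ n) :
    ∃ s lam, IsBasis n m X.values s lam := by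
  have hg1 : ∀ k, k ∈ gen n m (fun _ => n) 1 ↔ ∃ a b, k = n + (n * a + m * b) := fun k => by
    rw [mem_gen]
    exact ⟨fun ⟨_, _, h⟩ => h, fun h => ⟨0, one_pos, h⟩⟩
  have hstart : PartialBasis n m X.values 1 fun _ => n := by
    refine ⟨le_rfl, rfl, fun i k _ _ => by omega, fun i _ _ => by omega, ?_, ?_⟩
    · intro k hk
      obtain ⟨a, b, rfl⟩ := (hg1 k).1 hk
      exact X.add_mem_values X.dx_value a b
    · intro k hk hk' i _
      refine lt_of_le_of_ne (X.le_of_mem_values hk) ?_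
      rintro rfl
      exact hk' ((hg1 n).2 ⟨0, 0, by simp⟩)
  obtain ⟨j, lam, h, hsub⟩ := hstart.exists_complete hco (by omega)
    fun k hk a b => X.add_mem_values hk a b
  -- The value m is not in n + Γ, so at least two generators are needed; this is the condition s ≥
  -- 0.
  have hj : 2 ≤ j := by
    by_contra hj
    obtain rfl : j = 1 := by have := h.one_le; omega
    obtain ⟨i, hi, a, b, hab⟩ := mem_gen.1 (hsub X.dy_value)
    obtain rfl : i = 0 := by omega
    rw [h.zero] at hab
    obtain rfl : b = 0 := by
      by_contra hb
      have := Nat.mul_le_mul_left m (Nat.one_le_iff_ne_zero.2 hb)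
      omega
    have : n ∣ m := ⟨a + 1, by rw [hab]; ring⟩
    have := Nat.Coprime.eq_one_of_dvd hco this
    omega
  obtain ⟨s, rfl⟩ := Nat.exists_eq_add_of_le hj
  rw [add_comm] at h hsub
  exact ⟨s, lam, h.increasing, h.not_mem, hsub.antisymm h.subset⟩

end CuspGeom

namespace CuspGeom

/-! ### The morphism of a cuspidal sequence in adapted coordinates -/

/-- All the points are corners, when the first blown-up point is one. -/
def IsToric (l : List DirPoint) : Prop := ∀ c ∈ l, c = .fin 0 ∨ c = .inf

/-- The points `P₂, P₃, …` of a cuspidal sequence: free points followed by corners. -/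
def IsCuspidalTail : List DirPoint → Prop
  | [] => True
  | .fin _ :: l => IsCuspidalTail l
  | .inf :: l => IsToric l

theorem IsToric.isCuspidalTail {l : List DirPoint} (h : IsToric l) : IsCuspidalTail l := by
  induction l with
  | nil => trivial
  | cons c l ih =>
    have hl : IsToric l := fun d hd => h d (List.mem_cons_of_mem _ hd)
    cases c with
    | fin c => exact ih hl
    | inf => exact hl

/-- The number of exceptional components at the last point of a list, starting from given
exceptional axes. -/
noncomputable def componentsFrom (K : Bool × Bool) (l : List DirPoint) : ℕ :=
  (l.foldl nextAxes K).1.toNat + (l.foldl nextAxes K).2.toNat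

theorem nextAxes_origin (c : DirPoint) : nextAxes (false, false) c = (true, false) := by
  cases c <;> simp [nextAxes]

theorem numComponents_cons (c : DirPoint) (l : List DirPoint) :
    numComponents (c :: l) = componentsFrom (true, false) l := by
  simp [numComponents, exceptionalAxes, componentsFrom, nextAxes_origin]

theorem nextAxes_corner_fin {c : ℂ} (hc : c ≠ 0) :
    nextAxes (true, true) (.fin c) = (true, false) := by
  simp [nextAxes, hc]

theorem nextAxes_corner {c : DirPoint} (h : c = .fin 0 ∨ c = .inf) :
    nextAxes (true, true) c = (true, true) := by
  rcases h with rfl | rfl <;> simp [nextAxes]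

theorem foldl_toric {l : List DirPoint} (h : IsToric l) :
    l.foldl nextAxes (true, true) = (true, true) := by
  induction l with
  | nil => rfl
  | cons c l ih =>
    rw [List.foldl_cons, nextAxes_corner (h c List.mem_cons_self)]
    exact ih fun d hd => h d (List.mem_cons_of_mem _ hd)

/-- Leaving the corners drops the number of components from 2 to 1, which monotonicity forbids. -/
theorem isToric_of_monotone {l : List DirPoint}
    (h : ∀ k, k < l.length → componentsFrom (true, true) (l.take k) ≤
      componentsFrom (true, true) (l.take (k + 1))) : IsToric l := by
  induction l with
  | nil => intro c hc; simp at hc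
  | cons c l ih =>
    have hc : c = .fin 0 ∨ c = .inf := by
      have h0 := h 0 (by simp)
      cases c with
      | inf => exact .inr rfl
      | fin c =>
        left
        by_contra hc
        have hc : c ≠ 0 := fun h => hc (by rw [h])
        simp [componentsFrom, nextAxes_corner_fin hc] at h0
    have hl : IsToric l := ih fun k hk => by
      have := h (k + 1) (by simpa using hk)
      simpa [componentsFrom, nextAxes_corner hc] using this
    intro d hd
    rcases List.mem_cons.1 hd with rfl | hd
    exacts [hc, hl d hd]

theorem isCuspidalTail_of_monotone {l : List DirPoint}
    (h : ∀ k, k < l.length → componentsFrom (true, false) (l.take k) ≤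
      componentsFrom (true, false) (l.take (k + 1))) : IsCuspidalTail l := by
  induction l with
  | nil => trivial
  | cons c l ih =>
    cases c with
    | fin c =>
      refine ih fun k hk => ?_
      have := h (k + 1) (by simpa using hk)
      simpa [componentsFrom, nextAxes] using this
    | inf =>
      refine isToric_of_monotone fun k hk => ?_
      have := h (k + 1) (by simpa using hk)
      simpa [componentsFrom, nextAxes] using this

theorem CuspidalSequence.isCuspidalTail {S : CuspidalSequence} {c : DirPoint}
    {l : List DirPoint} (h : S.centers = c :: l) : IsCuspidalTail l := by
  refine isCuspidalTail_of_monotone fun k hk => ?_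
  have := S.cuspidal (k + 2) (by omega) (by rw [h]; simpa using hk)
  rw [h] at this
  simpa [numComponents_cons] using this

/-- The orders along the last divisor of the coordinates at the first blown-up point. -/
def weights : List DirPoint → ℕ × ℕ
  | [] => (1, 1)
  | .fin _ :: l => ((weights l).1, (weights l).1 + (weights l).2)
  | .inf :: l => ((weights l).1 + (weights l).2, (weights l).1)

theorem weights_pos (l : List DirPoint) : 1 ≤ (weights l).1 ∧ 1 ≤ (weights l).2 := by
  induction l with
  | nil => exact ⟨le_rfl, le_rfl⟩
  | cons c l ih => cases c <;> simp only [weights] <;> omega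

theorem freenessIndex_fin (c : DirPoint) (d : ℂ) (l : List DirPoint) :
    2 ≤ freenessIndex (c :: .fin d :: l) := by
  have h : ({1, 2} : Finset ℕ) ⊆ (Finset.Icc 1 (c :: .fin d :: l).length).filter
      fun k => numComponents ((c :: .fin d :: l).take k) = 1 := by
    intro k hk
    rw [Finset.mem_insert, Finset.mem_singleton] at hk
    rcases hk with rfl | rfl <;> simp [numComponents_cons, componentsFrom, nextAxes]
  exact (Finset.card_le_card h).trans' (by simp)

theorem freenessIndex_inf {c : DirPoint} {l : List DirPoint} (h : IsToric l) :
    ¬ 2 ≤ freenessIndex (c :: .inf :: l) := by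
  have h : (Finset.Icc 1 (c :: .inf :: l).length).filter
      (fun k => numComponents ((c :: .inf :: l).take k) = 1) ⊆ {1} := by
    intro k hk
    rw [Finset.mem_filter, Finset.mem_Icc] at hk
    obtain ⟨⟨h1, -⟩, hk⟩ := hk
    rw [Finset.mem_singleton]
    by_contra hne
    obtain ⟨j, rfl⟩ : ∃ j, k = j + 2 := ⟨k - 2, by omega⟩
    have ht : IsToric (l.take j) := fun d hd => h d (List.mem_of_mem_take hd)
    simp [numComponents_cons, componentsFrom, nextAxes, foldl_toric ht] at hk
  have := Finset.card_le_card h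
  rw [Finset.card_singleton] at this
  unfold freenessIndex
  omega

theorem freenessIndex_singleton (c : DirPoint) : ¬ 2 ≤ freenessIndex [c] := by
  have := Finset.card_filter_le (Finset.Icc 1 [c].length)
    fun k => numComponents ([c].take k) = 1
  simp only [List.length_singleton, Nat.card_Icc] at this
  unfold freenessIndex
  simp only [List.length_singleton]
  omega

/-- P₁ is always free, so f ≥ 2 holds exactly when P₂ exists and is free. The recursion of the
Puiseux pair thus follows that of the orders along E. -/
theorem puiseuxPairAux_cons {l : List DirPoint} (h : IsCuspidalTail l) (c : DirPoint) :
    puiseuxPairAux (c :: l) = ((weights l).1, (weights l).1 + (weights l).2) := by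
  induction l generalizing c with
  | nil => rw [puiseuxPairAux, if_neg (freenessIndex_singleton c)]; rfl
  | cons d l ih =>
    cases d with
    | fin d =>
      rw [puiseuxPairAux, if_pos (freenessIndex_fin c d l), ih h]
      simp only [weights, Prod.mk.injEq, true_and]
      ring
    | inf =>
      have h' : IsToric l := h
      rw [puiseuxPairAux, if_neg (freenessIndex_inf h'), ih h'.isCuspidalTail]
      simp only [weights, Prod.mk.injEq, true_and]
      ring

/-- A monomial map in the coordinates `(u, v + e)`. -/
def monomialMap (a b p q : ℕ) (e : ℂ) (z : ℂ × ℂ) : ℂ × ℂ :=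
  (z.1 ^ a * (z.2 + e) ^ p, z.1 ^ b * (z.2 + e) ^ q)

/-- Each corner chart acts on the exponents by an integer matrix of determinant ±1, so the
determinant stays ±1. Only the last chart can bring in the constant e. -/
theorem composedChart_toric {l : List DirPoint} (h : IsToric l) (Q : DirPoint) :
    ∃ p q e, (e ≠ 0 ↔ ∃ c ≠ 0, Q = .fin c) ∧
      ((weights l).1 * q = (weights l).2 * p + 1 ∨ (weights l).1 * q + 1 = (weights l).2 * p) ∧
      composedChart (l ++ [Q]) = monomialMap (weights l).1 (weights l).2 p q e := by
  induction l with
  | nil =>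
    cases Q with
    | fin c =>
      refine ⟨0, 1, c, by simp, by simp [weights], ?_⟩
      ext z <;> simp [composedChart, blowChart, monomialMap, weights]
    | inf =>
      refine ⟨1, 0, 0, by simp, by simp [weights], ?_⟩
      ext z <;> simp [composedChart, blowChart, monomialMap, weights]
  | cons c l ih =>
    obtain ⟨p, q, e, he, hd, hmap⟩ := ih fun d hd => h d (List.mem_cons_of_mem _ hd)
    rcases h c List.mem_cons_self with rfl | rfl
    · refine ⟨p, p + q, e, he, ?_, ?_⟩
      · simp only [weights, mul_add, add_mul]
        rcases hd with hd | hd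
        exacts [.inl (by omega), .inr (by omega)]
      · rw [List.cons_append, composedChart, hmap]
        ext z
        · simp [blowChart, monomialMap, weights]
        · simp [blowChart, monomialMap, weights]
          ring
    · refine ⟨p + q, p, e, he, ?_, ?_⟩
      · simp only [weights, mul_add, add_mul]
        rcases hd with hd | hd
        exacts [.inr (by omega), .inl (by omega)]
      · rw [List.cons_append, composedChart, hmap]
        ext z
        · simp [blowChart, monomialMap, weights]
          ring
        · simp [blowChart, monomialMap, weights]

/-- A chart at a free point is monomial up to adding a function of x, and such functions accumulate
in P. The condition on the weights forces a corner to occur, so Q affects only the monomial part and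
the same P serves every Q. -/
theorem composedChart_tail {l : List DirPoint} (h : IsCuspidalTail l) (hw : 2 ≤ (weights l).1) :
    ∃ P : ℂ → ℂ, Differentiable ℂ P ∧ ∀ Q, ∃ p q e, (e ≠ 0 ↔ ∃ c ≠ 0, Q = .fin c) ∧
      ((weights l).1 * q = (weights l).2 * p + 1 ∨ (weights l).1 * q + 1 = (weights l).2 * p) ∧
      ∀ z, composedChart (l ++ [Q]) z =
        ((monomialMap (weights l).1 (weights l).2 p q e z).1,
          (monomialMap (weights l).1 (weights l).2 p q e z).2 +
            P (monomialMap (weights l).1 (weights l).2 p q e z).1) := by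
  induction l with
  | nil => simp [weights] at hw
  | cons c l ih =>
    cases c with
    | fin c =>
      obtain ⟨P, hP, hQ⟩ := ih h hw
      refine ⟨fun x => x * (P x + c), by fun_prop, fun Q => ?_⟩
      obtain ⟨p, q, e, he, hd, hmap⟩ := hQ Q
      refine ⟨p, p + q, e, he, ?_, fun z => ?_⟩
      · simp only [weights, mul_add, add_mul]
        rcases hd with hd | hd
        exacts [.inl (by omega), .inr (by omega)]
      · rw [List.cons_append, composedChart, Function.comp_apply, hmap]
        ext
        · simp [blowChart, monomialMap, weights]
        · simp [blowChart, monomialMap, weights]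
          ring
    | inf =>
      have ht : IsToric (.inf :: l) := fun d hd => by
        rcases List.mem_cons.1 hd with rfl | hd
        exacts [.inr rfl, h d hd]
      refine ⟨fun _ => 0, by fun_prop, fun Q => ?_⟩
      obtain ⟨p, q, e, he, hd, hmap⟩ := composedChart_toric ht Q
      exact ⟨p, q, e, he, hd, fun z => by rw [hmap]; simp⟩

/-- Since n ≥ 2 the last centre is a corner, so on E the points that are not free are the directions
`fin 0` and `inf`. -/
theorem foldl_tail {l : List DirPoint} (h : IsCuspidalTail l) (hw : 2 ≤ (weights l).1) :
    l.foldl nextAxes (true, false) = (true, true) := by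
  induction l with
  | nil => simp [weights] at hw
  | cons c l ih =>
    cases c with
    | fin c =>
      rw [List.foldl_cons, ← ih h hw]
      simp [nextAxes]
    | inf => exact foldl_toric h

/-- In suitable coordinates of the ambient germ, which do not depend on the point `Q` of the last
divisor, the morphism of a cuspidal sequence with Puiseux pair `(n, m)`, `n ≥ 2`, is monomial. -/
theorem CuspidalSequence.exists_coordinates (S : CuspidalSequence) {n m : ℕ}
    (hS : S.puiseuxPair = (n, m)) (hn : 2 ≤ n) :
    Nat.Coprime n m ∧ n < m ∧ ∃ Φ Ψ : ℂ × ℂ → ℂ × ℂ,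
      (∀ z, AnalyticAt ℂ Φ z) ∧ (∀ z, AnalyticAt ℂ Ψ z) ∧ (∀ z, Φ (Ψ z) = z) ∧
      (∀ z, Ψ (Φ z) = z) ∧ Φ 0 = 0 ∧
      ∀ Q, ∃ p q e, (S.IsFree Q ↔ e ≠ 0) ∧ (n * q = m * p + 1 ∨ n * q + 1 = m * p) ∧
        S.proj Q = Φ ∘ monomialMap n m p q e := by
  obtain ⟨c, l, hcl⟩ : ∃ c l, S.centers = c :: l := by
    rcases hc : S.centers with _ | ⟨c, l⟩
    · rw [puiseuxPair, hc] at hS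
      simp only [puiseuxPairAux, Prod.mk.injEq] at hS
      omega
    · exact ⟨c, l, rfl⟩
  have ht := S.isCuspidalTail hcl
  rw [puiseuxPair, hcl, puiseuxPairAux_cons ht] at hS
  simp only [Prod.mk.injEq] at hS
  obtain ⟨hn', hm'⟩ := hS
  obtain ⟨P, hP, hQ⟩ := composedChart_tail ht (by omega)
  have hPa : ∀ z, AnalyticAt ℂ P z := fun z => hP.analyticAt z
  have hPfst : ∀ z : ℂ × ℂ, AnalyticAt ℂ (fun z : ℂ × ℂ => P z.1) z := fun z =>
    AnalyticAt.comp_of_eq (hPa z.1) analyticAt_fst rfl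
  have hPsnd : ∀ z : ℂ × ℂ, AnalyticAt ℂ (fun z : ℂ × ℂ => P z.2) z := fun z =>
    AnalyticAt.comp_of_eq (hPa z.2) analyticAt_snd rfl
  have hfree : ∀ Q, S.IsFree Q ↔ ∃ c ≠ 0, Q = .fin c := by
    intro Q
    have hf := foldl_tail ht (by omega)
    rw [IsFree, hcl, List.cons_append, numComponents_cons, componentsFrom, List.foldl_append, hf]
    cases Q with
    | inf => simp [nextAxes]
    | fin c =>
      by_cases hc : c = 0 <;> simp [nextAxes, hc]
  have hdet : ∀ p q, ((weights l).1 * q = (weights l).2 * p + 1 ∨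
      (weights l).1 * q + 1 = (weights l).2 * p) →
      (n * (p + q) = m * p + 1 ∨ n * (p + q) + 1 = m * p) := by
    intro p q hd
    rw [← hm', ← hn', mul_add, add_mul]
    rcases hd with hd | hd
    exacts [.inl (by omega), .inr (by omega)]
  refine ⟨?_, ?_, ?_⟩
  · obtain ⟨p, q, e, -, hd, -⟩ := hQ .inf
    have hco : ∀ d, d ∣ n → d ∣ m → d = 1 := by
      intro d h1 h2
      rcases hdet p q hd with h | h
      · have h3 : d ∣ m * p + 1 := h ▸ h1.mul_right _
        exact Nat.dvd_one.1 ((Nat.dvd_add_right (h2.mul_right p)).1 h3)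
      · have h3 : d ∣ n * (p + q) + 1 := h ▸ h2.mul_right _
        exact Nat.dvd_one.1 ((Nat.dvd_add_right (h1.mul_right _)).1 h3)
    exact hco _ (Nat.gcd_dvd_left _ _) (Nat.gcd_dvd_right _ _)
  · have := (weights_pos l).2
    omega
  · cases c with
    | fin c =>
      refine ⟨fun z => (z.1, z.2 + z.1 * (P z.1 + c)), fun z => (z.1, z.2 - z.1 * (P z.1 + c)),
        fun z => analyticAt_fst.prod
          (analyticAt_snd.add (analyticAt_fst.mul ((hPfst z).add analyticAt_const))),
        fun z => analyticAt_fst.prod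
          (analyticAt_snd.sub (analyticAt_fst.mul ((hPfst z).add analyticAt_const))),
        by simp, by simp, by simp, fun Q => ?_⟩
      obtain ⟨p, q, e, he, hd, hmap⟩ := hQ Q
      refine ⟨p, p + q, e, (hfree Q).trans he.symm, hdet p q hd, ?_⟩
      funext z
      rw [proj, hcl, List.cons_append, composedChart, Function.comp_apply, hmap, ← hm', ← hn']
      ext
      · simp [blowChart, monomialMap]
      · simp [blowChart, monomialMap]
        ring
    | inf =>
      refine ⟨fun z => (z.2 + z.1 * P z.1, z.1), fun z => (z.2, z.1 - z.2 * P z.2),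
        fun z => (analyticAt_snd.add (analyticAt_fst.mul (hPfst z))).prod analyticAt_fst,
        fun z => analyticAt_snd.prod (analyticAt_fst.sub (analyticAt_snd.mul (hPsnd z))),
        by simp, by simp, by simp, fun Q => ?_⟩
      obtain ⟨p, q, e, he, hd, hmap⟩ := hQ Q
      refine ⟨p, p + q, e, (hfree Q).trans he.symm, hdet p q hd, ?_⟩
      funext z
      rw [proj, hcl, List.cons_append, composedChart, Function.comp_apply, hmap, ← hm', ← hn']
      ext
      · simp [blowChart, monomialMap]
        ring
      · simp [blowChart, monomialMap]

end CuspGeom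

namespace CuspGeom

noncomputable section

/-! ### Functions and forms in two variables -/

/-- The functions on `ℂ²` that are analytic at the origin. -/
def analyticFunctions : Subalgebra ℂ (ℂ × ℂ → ℂ) where
  carrier := {f | AnalyticAt ℂ f 0}
  mul_mem' := fun hf hg => AnalyticAt.mul hf hg
  add_mem' := fun hf hg => AnalyticAt.add hf hg
  algebraMap_mem' := fun _ => analyticAt_const

/-- The coordinate function `x`. -/
def coordX : analyticFunctions := ⟨Prod.fst, analyticAt_fst⟩

/-- The coordinate function `y`. -/
def coordY : analyticFunctions := ⟨Prod.snd, analyticAt_snd⟩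

/-- The shifted power series sums to an analytic family L of linear forms with f(z) = f(0) +
L(z)(z); g and h are the two coordinates of L. -/
theorem hadamard_eventually {f : ℂ × ℂ → ℂ} (hf : AnalyticAt ℂ f 0) :
    ∃ g h : ℂ × ℂ → ℂ, AnalyticAt ℂ g 0 ∧ AnalyticAt ℂ h 0 ∧
      ∀ᶠ z in 𝓝 (0 : ℂ × ℂ), f z = f 0 + z.1 * g z + z.2 * h z := by
  obtain ⟨p, r, hp⟩ := hf
  have hrad : 0 < p.shift.radius := by
    rw [FormalMultilinearSeries.radius_shift]
    exact hp.r_pos.trans_le hp.r_le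
  have hL := p.shift.hasFPowerSeriesOnBall hrad
  have hLa : AnalyticAt ℂ p.shift.sum 0 := hL.analyticAt
  refine ⟨fun z => p.shift.sum z (1, 0), fun z => p.shift.sum z (0, 1),
    ((ContinuousLinearMap.apply ℂ ℂ ((1, 0) : ℂ × ℂ)).analyticAt _).comp hLa,
    ((ContinuousLinearMap.apply ℂ ℂ ((0, 1) : ℂ × ℂ)).analyticAt _).comp hLa, ?_⟩
  filter_upwards [Metric.eball_mem_nhds (0 : ℂ × ℂ) hp.r_pos,
    Metric.eball_mem_nhds (0 : ℂ × ℂ) hrad] with z hz hz'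
  have h1 := hp.hasSum hz
  have h2 := (ContinuousLinearMap.apply ℂ ℂ z).hasSum (hL.hasSum hz')
  have h3 : ∀ k, p.shift k (fun _ => z) z = p (k + 1) fun _ => z := fun k => by
    have : (Fin.snoc (fun _ : Fin k => z) z : Fin (k + 1) → ℂ × ℂ) = fun _ => z := by
      funext i
      refine Fin.lastCases ?_ (fun j => ?_) i <;> simp
    rw [FormalMultilinearSeries.shift, ContinuousMultilinearMap.curryRight_apply, this]
  simp only [ContinuousLinearMap.apply_apply, h3, zero_add] at h1 h2
  have h4 := h1.unique ((hasSum_nat_add_iff 1).1 h2)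
  have h5 : z = z.1 • ((1, 0) : ℂ × ℂ) + z.2 • ((0, 1) : ℂ × ℂ) := by ext <;> simp
  have h6 : p.shift.sum z z = z.1 * p.shift.sum z (1, 0) + z.2 * p.shift.sum z (0, 1) := by
    nth_rewrite 2 [h5]
    rw [map_add, map_smul, map_smul, smul_eq_mul, smul_eq_mul]
  rw [h4, h6, Finset.sum_range_one, hp.coeff_zero]
  ring

/-- Elements of `analyticFunctions` are functions rather than germs, so the identity must hold
everywhere. Where the local one fails, g and h are redefined by division, which does not affect
analyticity at 0. -/
theorem exists_hadamard (f : analyticFunctions) :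
    ∃ g h : analyticFunctions, f = algebraMap ℂ _ (f.1 0) + coordX * g + coordY * h := by
  obtain ⟨g, h, hg, hh, he⟩ := hadamard_eventually f.2
  classical
  let P : ℂ × ℂ → Prop := fun z => f.1 z = f.1 0 + z.1 * g z + z.2 * h z
  let g' : ℂ × ℂ → ℂ := fun z => if P z then g z else (f.1 z - f.1 0) / z.1
  let h' : ℂ × ℂ → ℂ := fun z => if P z then h z else
    if z.1 = 0 then (f.1 z - f.1 0) / z.2 else 0
  have hg' : AnalyticAt ℂ g' 0 := hg.congr (he.mono fun z hz => (if_pos hz).symm)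
  have hh' : AnalyticAt ℂ h' 0 := hh.congr (he.mono fun z hz => (if_pos hz).symm)
  refine ⟨⟨g', hg'⟩, ⟨h', hh'⟩, Subtype.ext (funext fun z => ?_)⟩
  change f.1 z = f.1 0 + z.1 * g' z + z.2 * h' z
  by_cases hP : P z
  · simp only [g', h', if_pos hP]
    exact hP
  · have hz : z ≠ 0 := by
      rintro rfl
      exact hP (by simp [P])
    by_cases h1 : z.1 = 0
    · have h2 : z.2 ≠ 0 := fun h2 => hz (Prod.ext h1 h2)
      simp only [g', h', if_neg hP, h1, if_true, mul_div_cancel₀ _ h2]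
      ring
    · simp only [g', h', if_neg hP, h1]
      field_simp
      simp

/-- The forms `A dx + B dy` with `A` and `B` analytic at the origin. -/
abbrev Forms := analyticFunctions × analyticFunctions

instance : SMulCommClass analyticFunctions ℂ Forms where
  smul_comm f c v := by
    ext1 <;> exact mul_smul_comm c f _

/-- The form `x ^ a y ^ b dx`. -/
def monoDx (a b : ℕ) : Forms := (coordX ^ a * coordY ^ b, 0)

/-- The form `x ^ a y ^ b dy`. -/
def monoDy (a b : ℕ) : Forms := (0, coordX ^ a * coordY ^ b)

/-- The forms generated by the monomial forms of weight at least `d`. -/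
def weightSubmodule (n m d : ℕ) : Submodule analyticFunctions Forms :=
  Submodule.span _ ({v | ∃ a b, d ≤ n * (a + 1) + m * b ∧ v = monoDx a b} ∪
    {v | ∃ a b, d ≤ n * a + m * (b + 1) ∧ v = monoDy a b})

theorem monoDx_mem {n m d a b : ℕ} (h : d ≤ n * (a + 1) + m * b) :
    monoDx a b ∈ weightSubmodule n m d :=
  Submodule.subset_span (.inl ⟨a, b, h, rfl⟩)

theorem monoDy_mem {n m d a b : ℕ} (h : d ≤ n * a + m * (b + 1)) :
    monoDy a b ∈ weightSubmodule n m d :=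
  Submodule.subset_span (.inr ⟨a, b, h, rfl⟩)

theorem weightSubmodule_induction {n m d : ℕ} {p : Forms → Prop}
    (hdx : ∀ a b, d ≤ n * (a + 1) + m * b → p (monoDx a b))
    (hdy : ∀ a b, d ≤ n * a + m * (b + 1) → p (monoDy a b))
    (h0 : p 0) (hadd : ∀ v w, p v → p w → p (v + w))
    (hsmul : ∀ (f : analyticFunctions) v, p v → p (f • v)) {v : Forms}
    (hv : v ∈ weightSubmodule n m d) : p v := by
  induction hv using Submodule.span_induction with
  | mem v hv =>
    rcases hv with ⟨a, b, h, rfl⟩ | ⟨a, b, h, rfl⟩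
    exacts [hdx a b h, hdy a b h]
  | zero => exact h0
  | add v w _ _ hv hw => exact hadd v w hv hw
  | smul f v _ hv => exact hsmul f v hv

theorem weightSubmodule_anti (n m : ℕ) : Antitone (weightSubmodule n m) := by
  intro d e hde v hv
  refine weightSubmodule_induction (fun a b h => monoDx_mem (hde.trans h))
    (fun a b h => monoDy_mem (hde.trans h)) (Submodule.zero_mem _)
    (fun _ _ => Submodule.add_mem _) (fun f _ => Submodule.smul_mem _ f) hv

theorem smul_monoDx (a b c d : ℕ) :
    (coordX ^ a * coordY ^ b) • monoDx c d = monoDx (a + c) (b + d) := by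
  ext1
  · simp only [monoDx, Prod.smul_fst, smul_eq_mul]
    ring
  · simp [monoDx]

theorem smul_monoDy (a b c d : ℕ) :
    (coordX ^ a * coordY ^ b) • monoDy c d = monoDy (a + c) (b + d) := by
  ext1
  · simp [monoDy]
  · simp only [monoDy, Prod.smul_snd, smul_eq_mul]
    ring

theorem monomial_smul_mem {n m d : ℕ} (a b : ℕ) {v : Forms} (hv : v ∈ weightSubmodule n m d) :
    (coordX ^ a * coordY ^ b) • v ∈ weightSubmodule n m (d + (n * a + m * b)) := by
  refine weightSubmodule_induction
    (p := fun v => (coordX ^ a * coordY ^ b) • v ∈ weightSubmodule n m (d + (n * a + m * b)))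
    (fun c e h => ?_) (fun c e h => ?_) ?_ (fun v w hv hw => ?_) (fun f v hv => ?_) hv
  · rw [smul_monoDx]
    exact monoDx_mem (by linarith)
  · rw [smul_monoDy]
    exact monoDy_mem (by linarith)
  · simp
  · rw [smul_add]
    exact Submodule.add_mem _ hv hw
  · rw [smul_smul, mul_comm _ f, mul_smul]
    exact Submodule.smul_mem _ _ hv

theorem weightSubmodule_top {n m : ℕ} (h : n ≤ m) : weightSubmodule n m n = ⊤ := by
  rw [eq_top_iff]
  rintro ⟨A, B⟩ -
  have : ((A, B) : Forms) = A • monoDx 0 0 + B • monoDy 0 0 := by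
    ext1 <;> simp [monoDx, monoDy]
  rw [this]
  exact Submodule.add_mem _ (Submodule.smul_mem _ _ (monoDx_mem (by simp)))
    (Submodule.smul_mem _ _ (monoDy_mem (by simpa using h)))

/-- Modulo forms of higher weight, a form of weight `d` is a combination of monomial forms with
constant coefficients. -/
theorem mem_span_sup {n m d : ℕ} (hn : 0 < n) (hm : 0 < m) {v : Forms}
    (hv : v ∈ weightSubmodule n m d) :
    v ∈ Submodule.span ℂ ({v | ∃ a b, d = n * (a + 1) + m * b ∧ v = monoDx a b} ∪
      {v | ∃ a b, d = n * a + m * (b + 1) ∧ v = monoDy a b}) ⊔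
      (weightSubmodule n m (d + 1)).restrictScalars ℂ := by
  refine weightSubmodule_induction (fun a b h => ?_) (fun a b h => ?_) (Submodule.zero_mem _)
    (fun v w hv hw => Submodule.add_mem _ hv hw) (fun f v hv => ?_) hv
  · rcases h.eq_or_lt with h | h
    · exact Submodule.mem_sup_left (Submodule.subset_span (.inl ⟨a, b, h, rfl⟩))
    · exact Submodule.mem_sup_right (monoDx_mem h)
  · rcases h.eq_or_lt with h | h
    · exact Submodule.mem_sup_left (Submodule.subset_span (.inr ⟨a, b, h, rfl⟩))
    · exact Submodule.mem_sup_right (monoDy_mem h)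
  · obtain ⟨s, hs, r, hr, rfl⟩ := Submodule.mem_sup.1 hv
    have hs' : s ∈ weightSubmodule n m d := by
      change s ∈ (weightSubmodule n m d).restrictScalars ℂ
      refine Submodule.span_le.2 ?_ hs
      rintro w (⟨a, b, h, rfl⟩ | ⟨a, b, h, rfl⟩)
      exacts [monoDx_mem h.le, monoDy_mem h.le]
    obtain ⟨g, h, hf⟩ := exists_hadamard f
    rw [smul_add]
    refine Submodule.add_mem _ ?_ (Submodule.mem_sup_right (Submodule.smul_mem _ f hr))
    -- In f = f(0) + xg + yh, the last two terms raise the weight by n and m; only the constant f(0)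
    -- acts on the part of weight d.
    have h1 : f • s = f.1 0 • s + (g • (coordX ^ 1 * coordY ^ 0) • s +
        h • (coordX ^ 0 * coordY ^ 1) • s) := by
      nth_rewrite 1 [hf]
      simp only [add_smul, algebraMap_smul, pow_one, pow_zero, mul_one, one_mul, smul_smul,
        mul_comm g, mul_comm h, add_assoc]
    rw [h1]
    refine Submodule.add_mem _ (Submodule.mem_sup_left (Submodule.smul_mem _ _ hs))
      (Submodule.mem_sup_right (Submodule.add_mem _ ?_ ?_))
    · exact Submodule.smul_mem _ g (weightSubmodule_anti n m (by omega) (monomial_smul_mem 1 0 hs'))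
    · exact Submodule.smul_mem _ h (weightSubmodule_anti n m (by omega) (monomial_smul_mem 0 1 hs'))

/-- The form `m y dx - n x dy`. -/
def eulerForm (n m : ℕ) : Forms := (m : ℂ) • monoDx 0 1 - (n : ℂ) • monoDy 1 0

theorem monomial_smul_eulerForm (n m a b : ℕ) : (coordX ^ a * coordY ^ b) • eulerForm n m =
    (m : ℂ) • monoDx a (b + 1) - (n : ℂ) • monoDy (a + 1) b := by
  rw [eulerForm, smul_sub, smul_comm, smul_comm _ (n : ℂ), smul_monoDx, smul_monoDy]
  rfl

/-! ### Evaluation of forms along a parametrized curve -/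

/-- The coefficient `a(t)` of the restriction `a(t) dt / t` of a form to the curve
`(x(t), y(t))`. -/
def evalForm (x y : ℂ → ℂ) (v : Forms) (t : ℂ) : ℂ :=
  t * (v.1.1 (x t, y t) * deriv x t + v.2.1 (x t, y t) * deriv y t)

section Curve

variable {x y : ℂ → ℂ} {n m : ℕ}

theorem evalForm_add (v w : Forms) : evalForm x y (v + w) = evalForm x y v + evalForm x y w := by
  funext t
  change t * ((v.1.1 (x t, y t) + w.1.1 (x t, y t)) * deriv x t +
    (v.2.1 (x t, y t) + w.2.1 (x t, y t)) * deriv y t) = _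
  simp only [evalForm, Pi.add_apply]
  ring

theorem evalForm_smul (f : analyticFunctions) (v : Forms) :
    evalForm x y (f • v) = (fun t => f.1 (x t, y t)) * evalForm x y v := by
  funext t
  change t * ((f.1 (x t, y t) * v.1.1 (x t, y t)) * deriv x t +
    (f.1 (x t, y t) * v.2.1 (x t, y t)) * deriv y t) = _
  simp only [evalForm, Pi.mul_apply]
  ring

theorem evalForm_const_smul (c : ℂ) (v : Forms) :
    evalForm x y (c • v) = (fun _ => c) * evalForm x y v := by
  rw [← algebraMap_smul analyticFunctions c v, evalForm_smul]
  rfl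

theorem evalForm_sub (v w : Forms) : evalForm x y (v - w) = evalForm x y v - evalForm x y w := by
  have := evalForm_add (x := x) (y := y) (v - w) w
  rw [sub_add_cancel] at this
  rw [this, add_sub_cancel_right]

theorem evalForm_zero : evalForm x y 0 = 0 := by
  simpa using evalForm_sub (x := x) (y := y) 0 0

theorem evalForm_monoDx (a b : ℕ) :
    evalForm x y (monoDx a b) = x ^ a * y ^ b * (fun t => t * deriv x t) := by
  funext t
  change t * ((x t ^ a * y t ^ b) * deriv x t + 0 * deriv y t) = x t ^ a * y t ^ b * _
  ring

theorem evalForm_monoDy (a b : ℕ) :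
    evalForm x y (monoDy a b) = x ^ a * y ^ b * (fun t => t * deriv y t) := by
  funext t
  change t * (0 * deriv x t + (x t ^ a * y t ^ b) * deriv y t) = x t ^ a * y t ^ b * _
  ring

/-- `(x(t), y(t))` parametrizes a curve at the origin, with orders `n` and `m`. -/
structure IsCurve (x y : ℂ → ℂ) (n m : ℕ) : Prop where
  n_pos : 0 < n
  m_pos : 0 < m
  analytic_x : AnalyticAt ℂ x 0
  analytic_y : AnalyticAt ℂ y 0
  order_x : analyticOrderAt x 0 = n
  order_y : analyticOrderAt y 0 = m

theorem eq_zero_of_order {x : ℂ → ℂ} {n : ℕ} (hn : 0 < n) (h : analyticOrderAt x 0 = n) :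
    x 0 = 0 :=
  apply_eq_zero_of_analyticOrderAt_ne_zero (by rw [h]; exact_mod_cast hn.ne')

theorem analyticAt_mul_deriv {x : ℂ → ℂ} (hx : AnalyticAt ℂ x 0) :
    AnalyticAt ℂ (fun t => t * deriv x t) 0 :=
  analyticAt_id.mul hx.deriv

theorem order_mul_deriv {x : ℂ → ℂ} {n : ℕ} (hx : AnalyticAt ℂ x 0) (hn : 0 < n)
    (h : analyticOrderAt x 0 = n) : analyticOrderAt (fun t => t * deriv x t) 0 = n := by
  have h1 := hx.analyticOrderAt_deriv_add_one
  simp only [eq_zero_of_order hn h, sub_zero] at h1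
  have h2 : analyticOrderAt (id * deriv x) 0 = n := by
    rw [analyticOrderAt_mul analyticAt_id hx.deriv, analyticOrderAt_id, add_comm, h1, h]
  exact h2

/-- The Euler operator multiplies the leading term by the order. -/
theorem order_euler {x : ℂ → ℂ} {n : ℕ} (hx : AnalyticAt ℂ x 0) (hn : 0 < n)
    (h : analyticOrderAt x 0 = n) :
    (n + 1 : ℕ) ≤ analyticOrderAt (fun t => t * deriv x t - n * x t) 0 := by
  have hana : AnalyticAt ℂ (fun t => t * deriv x t - n * x t) 0 :=
    (analyticAt_mul_deriv hx).sub (analyticAt_const.mul hx)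
  obtain ⟨u, hu, -, hxu⟩ := hx.analyticOrderAt_eq_natCast.1 h
  rw [natCast_le_analyticOrderAt hana]
  refine ⟨deriv u, hu.deriv, ?_⟩
  filter_upwards [hxu.eventually_nhds, hu.eventually_analyticAt] with t ht hut
  have h1 : deriv x t = n * t ^ (n - 1) * u t + t ^ n * deriv u t := by
    rw [EventuallyEq.deriv_eq ht]
    simp only [sub_zero, smul_eq_mul]
    rw [deriv_fun_mul (by fun_prop) hut.differentiableAt]
    simp
  have h2 := ht.self_of_nhds
  simp only [sub_zero, smul_eq_mul] at h2 ⊢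
  rw [h1, h2]
  obtain ⟨n, rfl⟩ : ∃ k, n = k + 1 := ⟨n - 1, by omega⟩
  simp only [Nat.add_sub_cancel]
  ring

theorem IsCurve.map_zero (hc : IsCurve x y n m) : (x 0, y 0) = (0 : ℂ × ℂ) := by
  rw [eq_zero_of_order hc.n_pos hc.order_x, eq_zero_of_order hc.m_pos hc.order_y]
  rfl

theorem IsCurve.analyticAt_comp (hc : IsCurve x y n m) {f : ℂ × ℂ → ℂ}
    (hf : AnalyticAt ℂ f 0) : AnalyticAt ℂ (fun t => f (x t, y t)) 0 :=
  AnalyticAt.comp_of_eq (f := fun t => (x t, y t)) hf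
    (AnalyticAt.prod hc.analytic_x hc.analytic_y) hc.map_zero

theorem IsCurve.analyticAt_evalForm (hc : IsCurve x y n m) (v : Forms) :
    AnalyticAt ℂ (evalForm x y v) 0 :=
  analyticAt_id.mul (((hc.analyticAt_comp v.1.2).mul hc.analytic_x.deriv).add
    ((hc.analyticAt_comp v.2.2).mul hc.analytic_y.deriv))

theorem IsCurve.order_monomial (hc : IsCurve x y n m) (a b : ℕ) :
    analyticOrderAt (x ^ a * y ^ b) 0 = (n * a + m * b : ℕ) := by
  rw [analyticOrderAt_mul (hc.analytic_x.pow a) (hc.analytic_y.pow b),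
    analyticOrderAt_pow hc.analytic_x, analyticOrderAt_pow hc.analytic_y, hc.order_x, hc.order_y]
  simp [nsmul_eq_mul, mul_comm]

theorem IsCurve.order_monoDx (hc : IsCurve x y n m) (a b : ℕ) :
    analyticOrderAt (evalForm x y (monoDx a b)) 0 = (n * (a + 1) + m * b : ℕ) := by
  rw [evalForm_monoDx, analyticOrderAt_mul ((hc.analytic_x.pow a).mul (hc.analytic_y.pow b))
    (analyticAt_mul_deriv hc.analytic_x), hc.order_monomial,
    order_mul_deriv hc.analytic_x hc.n_pos hc.order_x]
  norm_cast
  ring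

theorem IsCurve.order_monoDy (hc : IsCurve x y n m) (a b : ℕ) :
    analyticOrderAt (evalForm x y (monoDy a b)) 0 = (n * a + m * (b + 1) : ℕ) := by
  rw [evalForm_monoDy, analyticOrderAt_mul ((hc.analytic_x.pow a).mul (hc.analytic_y.pow b))
    (analyticAt_mul_deriv hc.analytic_y), hc.order_monomial,
    order_mul_deriv hc.analytic_y hc.m_pos hc.order_y]
  norm_cast
  ring

theorem IsCurve.order_smul (hc : IsCurve x y n m) (f : analyticFunctions) (v : Forms) :
    analyticOrderAt (evalForm x y (f • v)) 0 =
      analyticOrderAt (fun t => f.1 (x t, y t)) 0 + analyticOrderAt (evalForm x y v) 0 := by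
  rw [evalForm_smul, analyticOrderAt_mul (hc.analyticAt_comp f.2) (hc.analyticAt_evalForm v)]

theorem IsCurve.order_const_smul (hc : IsCurve x y n m) {c : ℂ} (h : c ≠ 0) (v : Forms) :
    analyticOrderAt (evalForm x y (c • v)) 0 = analyticOrderAt (evalForm x y v) 0 := by
  have h0 : analyticOrderAt (fun _ : ℂ => c) 0 = 0 :=
    analyticAt_const.analyticOrderAt_eq_zero.2 h
  rw [evalForm_const_smul, analyticOrderAt_mul analyticAt_const (hc.analyticAt_evalForm v),
    h0, zero_add]

theorem IsCurve.order_monomial_smul (hc : IsCurve x y n m) (a b : ℕ) (v : Forms) :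
    analyticOrderAt (evalForm x y ((coordX ^ a * coordY ^ b) • v)) 0 =
      analyticOrderAt (evalForm x y v) 0 + (n * a + m * b : ℕ) := by
  rw [hc.order_smul, ← hc.order_monomial a b, add_comm]
  rfl

theorem IsCurve.le_order (hc : IsCurve x y n m) {d : ℕ} {v : Forms}
    (hv : v ∈ weightSubmodule n m d) : d ≤ analyticOrderAt (evalForm x y v) 0 := by
  refine weightSubmodule_induction (p := fun v => d ≤ analyticOrderAt (evalForm x y v) 0)
    (fun a b h => ?_) (fun a b h => ?_) ?_ (fun v w hv hw => ?_) (fun f v hv => ?_) hv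
  · rw [hc.order_monoDx]
    exact_mod_cast h
  · rw [hc.order_monoDy]
    exact_mod_cast h
  · rw [evalForm_zero, analyticOrderAt_eq_top.2 (by simp)]
    exact le_top
  · rw [evalForm_add]
    exact (le_min hv hw).trans le_analyticOrderAt_add
  · rw [hc.order_smul]
    exact hv.trans le_add_self

/-- On the curve the form gives m y (t x' − n x) − n x (t y' − m y): the terms mnxy cancel, and each
bracket has order above that of its coordinate. -/
theorem IsCurve.lt_order_eulerForm (hc : IsCurve x y n m) :
    (n + m : ℕ) < analyticOrderAt (evalForm x y (eulerForm n m)) 0 := by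
  have h : evalForm x y (eulerForm n m) =
      (fun _ => (m : ℂ)) * y * (fun t => t * deriv x t - n * x t) -
      (fun _ => (n : ℂ)) * x * (fun t => t * deriv y t - m * y t) := by
    rw [eulerForm, evalForm_sub, evalForm_const_smul, evalForm_const_smul, evalForm_monoDx,
      evalForm_monoDy]
    funext t
    simp only [Pi.sub_apply, Pi.mul_apply, Pi.pow_apply]
    ring
  have hx := order_euler hc.analytic_x hc.n_pos hc.order_x
  have hy := order_euler hc.analytic_y hc.m_pos hc.order_y
  have hax : AnalyticAt ℂ (fun t => t * deriv x t - n * x t) 0 :=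
    (analyticAt_mul_deriv hc.analytic_x).sub (analyticAt_const.mul hc.analytic_x)
  have hay : AnalyticAt ℂ (fun t => t * deriv y t - m * y t) 0 :=
    (analyticAt_mul_deriv hc.analytic_y).sub (analyticAt_const.mul hc.analytic_y)
  have h1 : (n + m + 1 : ℕ) ≤ analyticOrderAt (evalForm x y (eulerForm n m)) 0 := by
    rw [h]
    refine le_trans (le_min ?_ ?_) le_analyticOrderAt_sub
    · rw [analyticOrderAt_mul (analyticAt_const.mul hc.analytic_y) hax,
        analyticOrderAt_mul analyticAt_const hc.analytic_y, hc.order_y]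
      calc ((n + m + 1 : ℕ) : ℕ∞) = m + (n + 1 : ℕ) := by norm_cast; ring
        _ ≤ _ := add_le_add le_add_self hx
    · rw [analyticOrderAt_mul (analyticAt_const.mul hc.analytic_x) hay,
        analyticOrderAt_mul analyticAt_const hc.analytic_x, hc.order_x]
      calc ((n + m + 1 : ℕ) : ℕ∞) = n + (m + 1 : ℕ) := by norm_cast
        _ ≤ _ := add_le_add le_add_self hy
  exact lt_of_lt_of_le (by exact_mod_cast Nat.lt_succ_self _) h1

/-- Two analytic functions of the same finite order have proportional leading terms. -/
theorem exists_cancel {f g : ℂ → ℂ} {k : ℕ} (hf : AnalyticAt ℂ f 0) (hg : AnalyticAt ℂ g 0)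
    (hfk : analyticOrderAt f 0 = k) (hgk : analyticOrderAt g 0 = k) :
    ∃ c : ℂ, c ≠ 0 ∧ k < analyticOrderAt (f - (fun _ => c) * g) 0 := by
  obtain ⟨a, ha, ha0, hfa⟩ := hf.analyticOrderAt_eq_natCast.1 hfk
  obtain ⟨b, hb, hb0, hgb⟩ := hg.analyticOrderAt_eq_natCast.1 hgk
  refine ⟨a 0 / b 0, div_ne_zero ha0 hb0, ?_⟩
  have h1 : f - (fun _ => a 0 / b 0) * g =ᶠ[𝓝 0]
      (id ^ k) * (fun t => a t - a 0 / b 0 * b t) := by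
    filter_upwards [hfa, hgb] with t h2 h3
    simp only [Pi.sub_apply, Pi.mul_apply, Pi.pow_apply, h2, h3, sub_zero, smul_eq_mul, id]
    ring
  have hd : AnalyticAt ℂ (fun t => a t - a 0 / b 0 * b t) 0 :=
    ha.sub (analyticAt_const.mul hb)
  have h2 : analyticOrderAt (fun t => a t - a 0 / b 0 * b t) 0 ≠ 0 := by
    rw [hd.analyticOrderAt_ne_zero]
    field_simp
    simp
  have h3 : analyticOrderAt (id ^ k : ℂ → ℂ) 0 = k := by
    rw [analyticOrderAt_pow analyticAt_id, analyticOrderAt_id]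
    simp
  rw [analyticOrderAt_congr h1, analyticOrderAt_mul (analyticAt_id.pow k) hd, h3]
  refine (ENat.add_one_le_iff (ENat.natCast_ne_top k)).1 ?_
  gcongr
  exact Order.one_le_iff_ne_zero.2 h2

theorem IsCurve.order_eq_of_initial (hc : IsCurve x y n m) {d : ℕ} {c : ℂ} (h0 : c ≠ 0)
    {v w : Forms} (hw : analyticOrderAt (evalForm x y w) 0 = d)
    (h : (d + 1 : ℕ) ≤ analyticOrderAt (evalForm x y (v - c • w)) 0) :
    analyticOrderAt (evalForm x y v) 0 = d := by
  have h1 : v = c • w + (v - c • w) := by abel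
  rw [h1, evalForm_add, analyticOrderAt_add_eq_left_of_lt, hc.order_const_smul h0, hw]
  rw [hc.order_const_smul h0, hw]
  exact lt_of_lt_of_le (by exact_mod_cast Nat.lt_succ_self _) h

/-- Since d < nm, at most one monomial has weight d, which leaves at most one dx term and one dy
term. Both have value d, and only the resonant combination cancels it. -/
theorem IsCurve.graded (hc : IsCurve x y n m) (hco : Nat.Coprime n m) {d : ℕ} {v : Forms}
    (hd : d < n * m) (hv : v ∈ weightSubmodule n m d) :
    v ∈ weightSubmodule n m (d + 1) ∨
    analyticOrderAt (evalForm x y v) 0 = d ∧ d ∈ semigp n m ∨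
    ∃ (a b : ℕ) (c : ℂ), c ≠ 0 ∧ d = n * (a + 1) + m * (b + 1) ∧
      v - c • (coordX ^ a * coordY ^ b) • eulerForm n m ∈ weightSubmodule n m (d + 1) := by
  obtain ⟨s, hs, r, hr, rfl⟩ := Submodule.mem_sup.1 (mem_span_sup hc.n_pos hc.m_pos hv)
  have hr : r ∈ weightSubmodule n m (d + 1) := hr
  by_cases hS : ∃ i j, d = n * i + m * j
  swap
  · have hempty : s = 0 := by
      rw [Set.eq_empty_of_forall_notMem (s := _ ∪ _), Submodule.span_empty] at hs
      · exact hs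
      · rintro w (⟨a, b, h, -⟩ | ⟨a, b, h, -⟩)
        exacts [hS ⟨_, _, h⟩, hS ⟨_, _, h⟩]
    left
    rwa [hempty, zero_add]
  obtain ⟨i, j, hij⟩ := hS
  have hsg : d ∈ semigp n m := ⟨i, j, by rw [hij]; ring⟩
  have huniq : ∀ a b, d = n * a + m * b → a = i ∧ b = j := fun a b h =>
    weight_unique hco (by omega) (by omega)
  have hpure : ∀ (c : ℂ) (w : Forms), analyticOrderAt (evalForm x y w) 0 = d →
      c • w + r ∈ weightSubmodule n m (d + 1) ∨
      analyticOrderAt (evalForm x y (c • w + r)) 0 = d ∧ d ∈ semigp n m := by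
    intro c w hw
    by_cases h0 : c = 0
    · left
      rwa [h0, zero_smul, zero_add]
    · right
      refine ⟨hc.order_eq_of_initial h0 hw ?_, hsg⟩
      rw [add_sub_cancel_left]
      exact hc.le_order hr
  rcases i with _ | i <;> rcases j with _ | j
  · have hempty : s = 0 := by
      rw [Set.eq_empty_of_forall_notMem (s := _ ∪ _), Submodule.span_empty] at hs
      · exact hs
      · rintro w (⟨a, b, h, -⟩ | ⟨a, b, h, -⟩)
        · have := (huniq _ _ h).1; omega
        · have := (huniq _ _ h).2; omega
    left
    rwa [hempty, zero_add]
  · have h1 : s ∈ Submodule.span ℂ {monoDy 0 j} := by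
      refine Submodule.span_mono ?_ hs
      rintro w (⟨a, b, h, -⟩ | ⟨a, b, h, rfl⟩)
      · have := (huniq _ _ h).1; omega
      · obtain ⟨rfl, h2⟩ := huniq _ _ h
        obtain rfl : b = j := by omega
        rfl
    obtain ⟨c, rfl⟩ := Submodule.mem_span_singleton.1 h1
    exact (hpure c _ (by rw [hc.order_monoDy, hij])).imp_right .inl
  · have h1 : s ∈ Submodule.span ℂ {monoDx i 0} := by
      refine Submodule.span_mono ?_ hs
      rintro w (⟨a, b, h, rfl⟩ | ⟨a, b, h, -⟩)
      · obtain ⟨h2, rfl⟩ := huniq _ _ h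
        obtain rfl : a = i := by omega
        rfl
      · have := (huniq _ _ h).2; omega
    obtain ⟨c, rfl⟩ := Submodule.mem_span_singleton.1 h1
    exact (hpure c _ (by rw [hc.order_monoDx, hij])).imp_right .inl
  · have h1 : s ∈ Submodule.span ℂ {monoDx i (j + 1), monoDy (i + 1) j} := by
      refine Submodule.span_mono ?_ hs
      rintro w (⟨a, b, h, rfl⟩ | ⟨a, b, h, rfl⟩)
      · obtain ⟨h2, rfl⟩ := huniq _ _ h
        obtain rfl : a = i := by omega
        exact .inl rfl
      · obtain ⟨rfl, h2⟩ := huniq _ _ h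
        obtain rfl : b = j := by omega
        exact .inr rfl
    obtain ⟨μ, ζ, rfl⟩ := Submodule.mem_span_pair.1 h1
    have hn0 : (n : ℂ) ≠ 0 := by exact_mod_cast hc.n_pos.ne'
    -- The dy term is traded for a multiple of the resonant form; the remaining dx coefficient
    -- decides whether the value is d.
    have hdec : μ • monoDx i (j + 1) + ζ • monoDy (i + 1) j =
        (μ + ζ / n * m) • monoDx i (j + 1) -
          (ζ / n) • (coordX ^ i * coordY ^ j) • eulerForm n m := by
      rw [monomial_smul_eulerForm, smul_sub, smul_smul, smul_smul, div_mul_cancel₀ _ hn0]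
      module
    rw [hdec]
    by_cases h0 : μ + ζ / n * m = 0
    · rw [h0, zero_smul, zero_sub]
      by_cases hζ : ζ = 0
      · left
        simpa [hζ] using hr
      · right; right
        refine ⟨i, j, -(ζ / n), neg_ne_zero.2 (div_ne_zero hζ hn0), hij, ?_⟩
        generalize (coordX ^ i * coordY ^ j) • eulerForm n m = E
        have : -((ζ / n) • E) + r - (-(ζ / n)) • E = r := by module
        rwa [this]
    · right; left
      refine ⟨hc.order_eq_of_initial h0 (w := monoDx i (j + 1))
        (by rw [hc.order_monoDx, hij]) ?_, hsg⟩
      rw [show ∀ a b c : Forms, a - b + c - a = c - b from fun a b c => by abel, evalForm_sub]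
      refine le_trans (le_min (hc.le_order hr) ?_) le_analyticOrderAt_sub
      by_cases hζ : ζ = 0
      · rw [hζ, zero_div, zero_smul, evalForm_zero, analyticOrderAt_eq_top.2 (by simp)]
        exact le_top
      · rw [hc.order_const_smul (div_ne_zero hζ hn0), hc.order_monomial_smul]
        calc ((d + 1 : ℕ) : ℕ∞) = (n + m + 1 : ℕ) + (n * i + m * j : ℕ) := by
              rw [hij]; norm_cast; ring
          _ ≤ _ := by
              gcongr
              exact_mod_cast (ENat.add_one_le_iff (ENat.natCast_ne_top _)).2 hc.lt_order_eulerForm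

end Curve

end

end CuspGeom

namespace CuspGeom

noncomputable section

/-! ### Functions on a curve that extend to the plane -/

theorem exists_analytic_root {u : ℂ → ℂ} (hu : AnalyticAt ℂ u 0) (h0 : u 0 ≠ 0) {n : ℕ}
    (hn : 0 < n) : ∃ r : ℂ → ℂ, AnalyticAt ℂ r 0 ∧ r 0 ≠ 0 ∧ ∀ t, r t ^ n = u t := by
  obtain ⟨c, hc⟩ := IsAlgClosed.exists_pow_nat_eq (u 0) hn
  have hr : ∀ t, (c * (u t / u 0) ^ (n⁻¹ : ℂ)) ^ n = u t := fun t => by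
    rw [mul_pow, Complex.cpow_nat_inv_pow _ hn.ne', hc, mul_div_cancel₀ _ h0]
  refine ⟨fun t => c * (u t / u 0) ^ (n⁻¹ : ℂ), ?_, fun h => h0 ?_, hr⟩
  · refine analyticAt_const.mul ((hu.div analyticAt_const h0).cpow analyticAt_const ?_)
    simp [h0]
  · rw [← hr 0, show c * (u 0 / u 0) ^ (n⁻¹ : ℂ) = 0 from h, zero_pow hn.ne']

/-- An analytic function invariant under multiplication by the `n`-th roots of unity is a function
of the `n`-th power. -/
theorem exists_descent {g : ℂ → ℂ} (hg : AnalyticAt ℂ g 0) {n : ℕ} (hn : 0 < n)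
    (hinv : ∀ᶠ s in 𝓝 (0 : ℂ), ∀ z : ℂ, z ^ n = 1 → g (z * s) = g s) :
    ∃ f : ℂ → ℂ, AnalyticAt ℂ f 0 ∧ ∀ᶠ s in 𝓝 (0 : ℂ), g s = f (s ^ n) := by
  obtain ⟨r, hr, hball⟩ := Metric.eventually_nhds_iff_ball.1 (hinv.and hg.eventually_analyticAt)
  -- The principal n-th root is discontinuous on its cut, but two roots differ by a root of unity,
  -- to which g is insensitive.
  let f : ℂ → ℂ := fun w => g (w ^ (n⁻¹ : ℂ))
  have hf : ∀ s ∈ Metric.ball (0 : ℂ) r, f (s ^ n) = g s := by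
    intro s hs
    rcases eq_or_ne s 0 with rfl | hs0
    · have : (n⁻¹ : ℂ) ≠ 0 := by simp [hn.ne']
      simp [f, zero_pow hn.ne', Complex.zero_cpow this]
    · have h1 := (hball s hs).1 ((s ^ n) ^ (n⁻¹ : ℂ) / s) (by
        rw [div_pow, Complex.cpow_nat_inv_pow _ hn.ne', div_self (pow_ne_zero n hs0)])
      rwa [div_mul_cancel₀ _ hs0] at h1
  have hmem : ∀ ρ : ℂ, ‖ρ ^ n‖ < r ^ n → ρ ∈ Metric.ball (0 : ℂ) r := by
    intro ρ hρ
    rw [norm_pow] at hρ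
    rw [mem_ball_zero_iff]
    exact lt_of_pow_lt_pow_left₀ n hr.le hρ
  refine ⟨f, ?_, ?_⟩
  -- Away from 0, f equals g composed with a root analytic near w; at 0 continuity suffices, by
  -- removability of the singularity.
  · refine Complex.analyticAt_of_differentiable_on_punctured_nhds_of_continuousAt ?_ ?_
    · have hnear : Metric.ball (0 : ℂ) (r ^ n) ∈ 𝓝 0 := Metric.ball_mem_nhds _ (pow_pos hr n)
      filter_upwards [nhdsWithin_le_nhds hnear, self_mem_nhdsWithin] with w hw hw0
      have hw0 : w ≠ 0 := hw0
      obtain ⟨ξ, hξ⟩ := IsAlgClosed.exists_pow_nat_eq w hn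
      let ρ : ℂ → ℂ := fun t => ξ * (t / w) ^ (n⁻¹ : ℂ)
      have hρ : ∀ t, ρ t ^ n = t := fun t => by
        simp only [ρ]
        rw [mul_pow, Complex.cpow_nat_inv_pow _ hn.ne', hξ, mul_div_cancel₀ _ hw0]
      have hρa : AnalyticAt ℂ ρ w :=
        analyticAt_const.mul ((analyticAt_id.div analyticAt_const hw0).cpow analyticAt_const
          (by simp [hw0]))
      have hlt : ∀ t ∈ Metric.ball (0 : ℂ) (r ^ n), ρ t ∈ Metric.ball (0 : ℂ) r := fun t ht =>
        hmem _ (by rw [hρ]; simpa using ht)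
      have hfρ : f =ᶠ[𝓝 w] g ∘ ρ := by
        filter_upwards [Metric.isOpen_ball.mem_nhds hw] with t ht
        rw [Function.comp_apply, ← hf _ (hlt t ht), hρ]
      have hga := (hball _ (hlt w hw)).2
      exact ((hga.comp hρa).congr hfρ.symm).differentiableAt
    · have h0 : (0 : ℂ) ^ (n⁻¹ : ℂ) = 0 := Complex.zero_cpow (by simp [hn.ne'])
      have h1 : ContinuousAt (fun w : ℂ => w ^ (n⁻¹ : ℂ)) 0 := by
        refine Complex.continuousAt_cpow_const_of_re_pos (by simp) ?_
        rw [← Complex.ofReal_natCast, ← Complex.ofReal_inv, Complex.ofReal_re]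
        positivity
      exact ContinuousAt.comp_of_eq hg.continuousAt h1 h0
  · filter_upwards [Metric.ball_mem_nhds (0 : ℂ) hr] with s hs
    exact (hf s hs).symm

/-- A coordinate of a curve becomes a pure power after a change of parameter. -/
theorem exists_reparametrization {x : ℂ → ℂ} {n : ℕ} (hn : 0 < n) (hx : AnalyticAt ℂ x 0)
    (h : analyticOrderAt x 0 = n) :
    ∃ σ τ : ℂ → ℂ, AnalyticAt ℂ σ 0 ∧ AnalyticAt ℂ τ 0 ∧ σ 0 = 0 ∧ τ 0 = 0 ∧ deriv τ 0 ≠ 0 ∧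
      (∀ᶠ t in 𝓝 (0 : ℂ), x t = σ t ^ n) ∧ (∀ᶠ s in 𝓝 (0 : ℂ), σ (τ s) = s) ∧
      ∀ᶠ t in 𝓝 (0 : ℂ), τ (σ t) = t := by
  obtain ⟨u, hu, hu0, hxu⟩ := hx.analyticOrderAt_eq_natCast.1 h
  obtain ⟨r, hr, hr0, hru⟩ := exists_analytic_root hu hu0 hn
  let σ : ℂ → ℂ := fun t => t * r t
  have hσ : AnalyticAt ℂ σ 0 := analyticAt_id.mul hr
  have hσ0 : σ 0 = 0 := by simp [σ]
  have hσ' : deriv σ 0 ≠ 0 := by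
    have : deriv σ 0 = r 0 := by
      have h1 := (hasDerivAt_id (0 : ℂ)).mul hr.differentiableAt.hasDerivAt
      have h2 : deriv σ 0 = _ := h1.deriv
      simpa using h2
    rwa [this]
  have hτ := hσ.analyticAt_localInverse hσ'
  have h1 : ∀ᶠ t in 𝓝 (0 : ℂ), hσ.hasStrictDerivAt.localInverse _ _ _ hσ' (σ t) = t :=
    HasStrictDerivAt.eventually_left_inverse ..
  have h2 : ∀ᶠ s in 𝓝 (σ 0), σ (hσ.hasStrictDerivAt.localInverse _ _ _ hσ' s) = s :=
    HasStrictDerivAt.eventually_right_inverse ..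
  generalize hσ.hasStrictDerivAt.localInverse _ _ _ hσ' = τ at hτ h1 h2
  rw [hσ0] at hτ h2
  have hτ0 : τ 0 = 0 := by simpa [hσ0] using h1.self_of_nhds
  refine ⟨σ, τ, hσ, hτ, hσ0, hτ0, fun hd => ?_, ?_, h2, h1⟩
  · have h3 : HasDerivAt (σ ∘ τ) (deriv σ 0 * deriv τ 0) 0 :=
      HasDerivAt.comp_of_eq 0 hσ.differentiableAt.hasDerivAt hτ.differentiableAt.hasDerivAt hτ0.symm
    have h4 : HasDerivAt (σ ∘ τ) 1 0 :=
      (hasDerivAt_id (0 : ℂ)).congr_of_eventuallyEq h2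
    have := h3.unique h4
    simp [hd] at this
  · filter_upwards [hxu] with t ht
    rw [ht, mul_pow, hru]
    simp

/-- The polynomials `P s` depend analytically on `s` at the origin. -/
def AnalyticCoeffs (P : ℂ → Polynomial ℂ) : Prop :=
  ∀ b, AnalyticAt ℂ (fun s => (P s).coeff b) 0

theorem AnalyticCoeffs.mul {P Q : ℂ → Polynomial ℂ} (hP : AnalyticCoeffs P)
    (hQ : AnalyticCoeffs Q) : AnalyticCoeffs fun s => P s * Q s := by
  intro b
  simp only [Polynomial.coeff_mul]
  exact Finset.analyticAt_fun_sum _ fun i _ => (hP i.1).mul (hQ i.2)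

theorem AnalyticCoeffs.sum {ι : Type*} {P : ι → ℂ → Polynomial ℂ} (T : Finset ι)
    (hP : ∀ i ∈ T, AnalyticCoeffs (P i)) : AnalyticCoeffs fun s => ∑ i ∈ T, P i s := by
  intro b
  simp only [Polynomial.finsetSum_coeff]
  exact Finset.analyticAt_fun_sum _ fun i hi => hP i hi b

theorem analyticCoeffs_const (Q : Polynomial ℂ) : AnalyticCoeffs fun _ => Q :=
  fun _ => analyticAt_const

theorem analyticCoeffs_C {g : ℂ → ℂ} (hg : AnalyticAt ℂ g 0) :
    AnalyticCoeffs fun s => Polynomial.C (g s) := by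
  intro b
  simp only [Polynomial.coeff_C]
  split_ifs
  exacts [hg, analyticAt_const]

theorem AnalyticCoeffs.prod {ι : Type*} {P : ι → ℂ → Polynomial ℂ} (T : Finset ι)
    (hP : ∀ i ∈ T, AnalyticCoeffs (P i)) : AnalyticCoeffs fun s => ∏ i ∈ T, P i s := by
  classical
  induction T using Finset.induction_on with
  | empty => simpa using analyticCoeffs_const 1
  | insert i T hi ih =>
    simp only [Finset.prod_insert hi]
    exact (hP i (Finset.mem_insert_self i T)).mul
      (ih fun j hj => hP j (Finset.mem_insert_of_mem hj))

theorem analyticCoeffs_X_sub_C {g : ℂ → ℂ} (hg : AnalyticAt ℂ g 0) :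
    AnalyticCoeffs fun s => Polynomial.X - Polynomial.C (g s) := by
  intro b
  simp only [Polynomial.coeff_sub]
  exact analyticAt_const.sub (analyticCoeffs_C hg b)

/-! ### Lagrange interpolation over the conjugates s ↦ zs of the parameter. -/

theorem analyticAt_comp_const_mul {g : ℂ → ℂ} (hg : AnalyticAt ℂ g 0) (z : ℂ) :
    AnalyticAt ℂ (fun s => g (z * s)) 0 :=
  AnalyticAt.comp_of_eq (f := fun s => z * s) hg (analyticAt_const.mul analyticAt_id) (by simp)

/-- The `n`-th roots of unity. -/
abbrev rootsOfOne (n : ℕ) : Finset ℂ := Polynomial.nthRootsFinset n 1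

/-- The Lagrange interpolation polynomial of the values `q (z s)` at the points `y (z s)`, where
`z` runs over the `n`-th roots of unity, multiplied by the denominators. -/
def interpolation (n : ℕ) (y q : ℂ → ℂ) (s : ℂ) : Polynomial ℂ :=
  ∑ z ∈ rootsOfOne n, Polynomial.C (q (z * s)) *
    ∏ w ∈ (rootsOfOne n).erase z, (Polynomial.X - Polynomial.C (y (w * s)))

theorem analyticCoeffs_interpolation {n : ℕ} {y q : ℂ → ℂ} (hy : AnalyticAt ℂ y 0)
    (hq : AnalyticAt ℂ q 0) : AnalyticCoeffs (interpolation n y q) :=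
  AnalyticCoeffs.sum _ fun z _ => (analyticCoeffs_C (analyticAt_comp_const_mul hq z)).mul
    (AnalyticCoeffs.prod _ fun w _ => analyticCoeffs_X_sub_C (analyticAt_comp_const_mul hy w))

/-- Replacing s by ζs permutes the roots of unity in the sum and in the products. Hence the
coefficients are functions of s^n, which is x. -/
theorem interpolation_invariant {n : ℕ} (hn : 0 < n) (y q : ℂ → ℂ) {ζ : ℂ} (hζ : ζ ^ n = 1)
    (s : ℂ) : interpolation n y q (ζ * s) = interpolation n y q s := by
  have hζ0 : ζ ≠ 0 := by
    rintro rfl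
    rw [zero_pow hn.ne'] at hζ
    exact zero_ne_one hζ
  have hmem : ∀ z, z ∈ rootsOfOne n ↔ z * ζ ∈ rootsOfOne n := fun z => by
    rw [Polynomial.mem_nthRootsFinset hn, Polynomial.mem_nthRootsFinset hn, mul_pow, hζ, mul_one]
  let e : ℂ ≃ ℂ := Equiv.mulRight₀ ζ hζ0
  have he : ∀ z, e z = z * ζ := fun z => rfl
  refine Finset.sum_equiv e (fun z => by rw [he]; exact hmem z) fun z _ => ?_
  rw [he, mul_assoc]
  congr 1
  refine Finset.prod_equiv e (fun w => ?_) fun w _ => by rw [he, mul_assoc]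
  rw [he, Finset.mem_erase, Finset.mem_erase, ← hmem]
  simp [hζ0]

theorem eval_interpolation {n : ℕ} (hn : 0 < n) (y q : ℂ → ℂ) (s : ℂ) :
    (interpolation n y q s).eval (y s) =
      q s * ∏ w ∈ (rootsOfOne n).erase 1, (y s - y (w * s)) := by
  have h1 : (1 : ℂ) ∈ rootsOfOne n := Polynomial.one_mem_nthRootsFinset hn
  rw [interpolation, Polynomial.eval_finsetSum, Finset.sum_eq_single 1]
  · simp [Polynomial.eval_prod]
  · intro z _ hz
    rw [Polynomial.eval_mul, Polynomial.eval_prod,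
      Finset.prod_eq_zero (i := 1) (Finset.mem_erase.2 ⟨hz.symm, h1⟩) (by simp), mul_zero]
  · exact fun h => absurd h1 h

theorem natDegree_interpolation_lt (n : ℕ) (y q : ℂ → ℂ) (s : ℂ) :
    (interpolation n y q s).natDegree < (rootsOfOne n).card + 1 := by
  rw [Nat.lt_succ_iff]
  refine Polynomial.natDegree_sum_le_of_forall_le _ _ fun z _ => ?_
  refine (Polynomial.natDegree_C_mul_le _ _).trans ?_
  rw [Polynomial.natDegree_finsetProd_X_sub_C_eq_card]
  exact Finset.card_le_card (Finset.erase_subset _ _)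

theorem exists_interpolation {n : ℕ} (hn : 0 < n) {y q : ℂ → ℂ} (hy : AnalyticAt ℂ y 0)
    (hq : AnalyticAt ℂ q 0) : ∃ f : ℂ × ℂ → ℂ, AnalyticAt ℂ f 0 ∧ ∀ᶠ s in 𝓝 (0 : ℂ),
      f (s ^ n, y s) = q s * ∏ w ∈ (rootsOfOne n).erase 1, (y s - y (w * s)) := by
  have hdesc : ∀ b, ∃ f : ℂ → ℂ, AnalyticAt ℂ f 0 ∧
      ∀ᶠ s in 𝓝 (0 : ℂ), (interpolation n y q s).coeff b = f (s ^ n) := fun b =>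
    exists_descent (analyticCoeffs_interpolation hy hq b) hn
      (.of_forall fun s z hz => by rw [interpolation_invariant hn y q hz])
  choose f hf hfe using hdesc
  refine ⟨fun p => ∑ b ∈ Finset.range ((rootsOfOne n).card + 1), f b p.1 * p.2 ^ b, ?_, ?_⟩
  · refine Finset.analyticAt_fun_sum _ fun b _ => ?_
    exact (AnalyticAt.comp_of_eq (hf b) analyticAt_fst rfl).mul (analyticAt_snd.pow b)
  · have hall : ∀ᶠ s in 𝓝 (0 : ℂ), ∀ b ∈ Finset.range ((rootsOfOne n).card + 1),
        (interpolation n y q s).coeff b = f b (s ^ n) :=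
      (Filter.eventually_all_finset _).2 fun b _ => hfe b
    filter_upwards [hall] with s hs
    rw [← eval_interpolation hn, Polynomial.eval_eq_sum_range' (natDegree_interpolation_lt n y q s)]
    exact Finset.sum_congr rfl fun b hb => by rw [hs b hb]

/-- With y = s^m u, the factor of w is s^m (u(s) − w^m u(ws)). At s = 0 the bracket is (1 − w^m)
u(0) ≠ 0, because w ≠ 1, w^n = 1 and n, m are coprime. -/
theorem exists_discriminant {n m : ℕ} (hn : 0 < n) (hco : Nat.Coprime n m) {y : ℂ → ℂ}
    (hy : AnalyticAt ℂ y 0) (h : analyticOrderAt y 0 = m) :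
    ∃ (e : ℕ) (E : ℂ → ℂ), AnalyticAt ℂ E 0 ∧ E 0 ≠ 0 ∧ ∀ᶠ s in 𝓝 (0 : ℂ),
      ∏ w ∈ (rootsOfOne n).erase 1, (y s - y (w * s)) = s ^ e * E s := by
  obtain ⟨u, hu, hu0, hyu⟩ := hy.analyticOrderAt_eq_natCast.1 h
  refine ⟨m * ((rootsOfOne n).erase 1).card,
    fun s => ∏ w ∈ (rootsOfOne n).erase 1, (u s - w ^ m * u (w * s)), ?_, ?_, ?_⟩
  · exact Finset.analyticAt_fun_prod _ fun w _ =>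
      hu.sub (analyticAt_const.mul (analyticAt_comp_const_mul hu w))
  · refine Finset.prod_ne_zero_iff.2 fun w hw => ?_
    obtain ⟨hw1, hw⟩ := Finset.mem_erase.1 hw
    rw [Polynomial.mem_nthRootsFinset hn] at hw
    rw [mul_zero, sub_ne_zero]
    intro heq
    have hwm : w ^ m = 1 := by
      have := mul_right_cancel₀ hu0 ((one_mul (u 0)).trans heq)
      exact this.symm
    have := pow_gcd_eq_one.2 ⟨hw, hwm⟩
    rw [hco, pow_one] at this
    exact hw1 this
  · have hall : ∀ᶠ s in 𝓝 (0 : ℂ), ∀ w ∈ (rootsOfOne n).erase 1,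
        y (w * s) = (w * s) ^ m * u (w * s) := by
      refine (Filter.eventually_all_finset _).2 fun w _ => ?_
      have ht : Tendsto (fun s : ℂ => w * s) (𝓝 0) (𝓝 0) := by
        have : ContinuousAt (fun s : ℂ => w * s) 0 := by fun_prop
        simpa [ContinuousAt] using this
      filter_upwards [ht.eventually hyu] with s hs
      simpa using hs
    filter_upwards [hyu, hall] with s hs hws
    rw [pow_mul, ← Finset.prod_const, ← Finset.prod_mul_distrib]
    refine Finset.prod_congr rfl fun w hw => ?_
    rw [hws w hw, hs]
    simp only [sub_zero, smul_eq_mul]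
    ring

/-- Every analytic function of sufficiently high order on a curve is the restriction of a function
on the plane divisible by a given power of `x`. -/
theorem IsCurve.exists_extension {x y : ℂ → ℂ} {n m : ℕ} (hc : IsCurve x y n m)
    (hco : Nat.Coprime n m) : ∃ e : ℕ, ∀ (M : ℕ) (h : ℂ → ℂ), AnalyticAt ℂ h 0 →
      (n * M + e : ℕ) ≤ analyticOrderAt h 0 → ∃ f : ℂ × ℂ → ℂ, AnalyticAt ℂ f 0 ∧
        ∀ᶠ t in 𝓝 (0 : ℂ), h t = x t ^ M * f (x t, y t) := by
  obtain ⟨σ, τ, hσ, hτ, hσ0, hτ0, hτ', hxσ, hστ, hτσ⟩ :=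
    exists_reparametrization hc.n_pos hc.analytic_x hc.order_x
  have hyτ : AnalyticAt ℂ (y ∘ τ) 0 := hc.analytic_y.comp_of_eq hτ hτ0
  have hoτ : analyticOrderAt (y ∘ τ) 0 = m := by
    rw [analyticOrderAt_comp_of_deriv_ne_zero hτ hτ', hτ0, hc.order_y]
  obtain ⟨e, E, hE, hE0, hD⟩ := exists_discriminant hc.n_pos hco hyτ hoτ
  refine ⟨e, fun M h hh hord => ?_⟩
  have hhτ : AnalyticAt ℂ (h ∘ τ) 0 := hh.comp_of_eq hτ hτ0
  have hordτ : (n * M + e : ℕ) ≤ analyticOrderAt (h ∘ τ) 0 := by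
    rwa [analyticOrderAt_comp_of_deriv_ne_zero hτ hτ', hτ0]
  obtain ⟨k, hk, hhk⟩ := (natCast_le_analyticOrderAt hhτ).1 hordτ
  -- In the parameter s, h = s^(nM+e) k = s^(nM) · (s^e E) · (k/E). Interpolating k/E absorbs the
  -- discriminant s^e E.
  obtain ⟨f, hf, hfe⟩ := exists_interpolation hc.n_pos hyτ (hk.div hE hE0)
  refine ⟨f, hf, ?_⟩
  have hs : ∀ᶠ s in 𝓝 (0 : ℂ), h (τ s) = s ^ (n * M) * f (s ^ n, y (τ s)) := by
    filter_upwards [hhk, hfe, hD, hE.continuousAt.eventually_ne hE0] with s h1 h2 h3 h4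
    simp only [Function.comp_apply] at h1 h2 h3
    rw [h2, h3, h1, Pi.div_apply]
    simp only [sub_zero, smul_eq_mul]
    field_simp
    ring
  have hσt : Tendsto σ (𝓝 0) (𝓝 0) := by
    have := hσ.continuousAt
    rwa [ContinuousAt, hσ0] at this
  filter_upwards [hσt.eventually hs, hτσ, hxσ] with t h1 h2 h3
  rw [h2] at h1
  rw [h1, h3, pow_mul]

end

end CuspGeom

namespace CuspGeom

noncomputable section

/-! ### The forms along a curve as a `CuspModel`. -/

theorem IsCurve.completion {x y : ℂ → ℂ} {n m : ℕ} (hc : IsCurve x y n m)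
    (hco : Nat.Coprime n m) (d : ℕ) : ∃ K : ℕ, ∀ v : Forms,
      K ≤ analyticOrderAt (evalForm x y v) 0 →
      ∃ w ∈ weightSubmodule n m d, analyticOrderAt (evalForm x y (v - w)) 0 = ⊤ := by
  obtain ⟨e, he⟩ := hc.exists_extension hco
  obtain ⟨E, hE, hE0, hxE⟩ := (analyticAt_mul_deriv hc.analytic_x).analyticOrderAt_eq_natCast.1
    (order_mul_deriv hc.analytic_x hc.n_pos hc.order_x)
  -- A multiple of x^d dx suffices: n is the order of t x'(t), nd that of x^d, and e is the loss in
  -- the extension theorem.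
  refine ⟨n + (n * d + e), fun v hv => ?_⟩
  obtain ⟨g, hg, hvg⟩ := (natCast_le_analyticOrderAt (hc.analyticAt_evalForm v)).1 hv
  have hh : AnalyticAt ℂ (fun t => t ^ (n * d + e) * (g t / E t)) 0 :=
    (analyticAt_id.pow _).mul (hg.div hE hE0)
  obtain ⟨f, hf, hfe⟩ := he d _ hh ((natCast_le_analyticOrderAt hh).2
    ⟨fun t => g t / E t, hg.div hE hE0, .of_forall fun t => by simp⟩)
  refine ⟨(⟨f, hf⟩ : analyticFunctions) • monoDx d 0, Submodule.smul_mem _ _ (monoDx_mem ?_), ?_⟩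
  · have := Nat.mul_le_mul_right d hc.n_pos
    nlinarith
  · rw [analyticOrderAt_eq_top, evalForm_sub, evalForm_smul, evalForm_monoDx]
    filter_upwards [hvg, hfe, hxE, hE.continuousAt.eventually_ne hE0] with t h1 h2 h3 h4
    simp only [Pi.sub_apply, Pi.mul_apply, Pi.pow_apply, sub_zero, smul_eq_mul, pow_zero,
      mul_one] at h1 h2 h3 ⊢
    rw [h1, h3, show f (x t, y t) * (x t ^ d * (t ^ n * E t)) =
      (x t ^ d * f (x t, y t)) * (t ^ n * E t) by ring, ← h2]
    field_simp
    ring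

/-- The space of forms along a curve, with all its structure. -/
def IsCurve.model {x y : ℂ → ℂ} {n m : ℕ} (hc : IsCurve x y n m) (hco : Nat.Coprime n m)
    (hnm : n ≤ m) : CuspModel n m Forms where
  M a b := DistribSMul.toLinearMap ℂ Forms (coordX ^ a * coordY ^ b)
  F d := (weightSubmodule n m d).restrictScalars ℂ
  val v := analyticOrderAt (evalForm x y v) 0
  dx := monoDx 0 0
  dy := monoDy 0 0
  θ := eulerForm n m
  M_zero v := by
    change (coordX ^ 0 * coordY ^ 0) • v = v
    simp
  M_M a b c d v := by
    change (coordX ^ a * coordY ^ b) • (coordX ^ c * coordY ^ d) • v =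
      (coordX ^ (a + c) * coordY ^ (b + d)) • v
    rw [smul_smul]
    congr 1
    ring
  F_anti d e hde := fun _ hv => weightSubmodule_anti n m hde hv
  F_M a b d v hv := monomial_smul_mem a b hv
  F_top := by rw [weightSubmodule_top hnm]; rfl
  val_add v w := by
    rw [evalForm_add]
    exact le_analyticOrderAt_add
  val_smul c v hc0 := hc.order_const_smul hc0 v
  val_cancel k v w hv hw := by
    obtain ⟨c, hc0, h⟩ := exists_cancel (hc.analyticAt_evalForm v) (hc.analyticAt_evalForm w) hv hw
    exact ⟨c, hc0, by rwa [evalForm_sub, evalForm_const_smul]⟩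
  val_M a b v := hc.order_monomial_smul a b v
  val_F d v hv := hc.le_order hv
  dx_mem := monoDx_mem (by simp)
  dy_mem := monoDy_mem (by simp)
  θ_mem := by
    refine Submodule.sub_mem _ (Submodule.smul_mem _ _ ?_) (Submodule.smul_mem _ _ ?_)
    exacts [monoDx_mem (by simp), monoDy_mem (by simp)]
  val_dx := by rw [hc.order_monoDx]; simp
  val_dy := by rw [hc.order_monoDy]; simp
  val_θ := hc.lt_order_eulerForm
  graded d v hd hv := hc.graded hco hd hv
  completion := hc.completion hco

/-! ### Divisorial orders -/

theorem hasFDerivAt_monomial (a p : ℕ) (e : ℂ) (z : ℂ × ℂ) :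
    HasFDerivAt (fun z : ℂ × ℂ => z.1 ^ a * (z.2 + e) ^ p)
      ((z.1 ^ a * (p * (z.2 + e) ^ (p - 1))) • ContinuousLinearMap.snd ℂ ℂ ℂ +
        ((z.2 + e) ^ p * (a * z.1 ^ (a - 1))) • ContinuousLinearMap.fst ℂ ℂ ℂ) z := by
  have h1 := (hasFDerivAt_fst (𝕜 := ℂ) (p := z)).pow a
  have h2 := ((hasFDerivAt_snd (𝕜 := ℂ) (p := z)).add_const e).pow p
  refine (h1.mul h2).congr_fderiv ?_
  ext <;> simp

theorem hasFDerivAt_monomialMap (a b p q : ℕ) (e : ℂ) (z : ℂ × ℂ) :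
    HasFDerivAt (monomialMap a b p q e)
      (((z.1 ^ a * (p * (z.2 + e) ^ (p - 1))) • ContinuousLinearMap.snd ℂ ℂ ℂ +
        ((z.2 + e) ^ p * (a * z.1 ^ (a - 1))) • ContinuousLinearMap.fst ℂ ℂ ℂ).prod
      ((z.1 ^ b * (q * (z.2 + e) ^ (q - 1))) • ContinuousLinearMap.snd ℂ ℂ ℂ +
        ((z.2 + e) ^ q * (b * z.1 ^ (b - 1))) • ContinuousLinearMap.fst ℂ ℂ ℂ)) z :=
  (hasFDerivAt_monomial a p e z).prodMk (hasFDerivAt_monomial b q e z)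

theorem mul_natCast_mul_pow_pred (x : ℂ) (a : ℕ) : x * (a * x ^ (a - 1)) = a * x ^ a := by
  rcases a with _ | a
  · simp
  · simp only [Nat.add_sub_cancel]
    ring

theorem clm_apply_eq (L : ℂ × ℂ →L[ℂ] ℂ) (h : ℂ × ℂ) :
    L h = h.1 * L (1, 0) + h.2 * L (0, 1) := by
  have : h = h.1 • ((1, 0) : ℂ × ℂ) + h.2 • ((0, 1) : ℂ × ℂ) := by ext <;> simp
  nth_rewrite 1 [this]
  rw [map_add, map_smul, map_smul, smul_eq_mul, smul_eq_mul]

theorem fst_mul_pullback_monomialMap (a b p q : ℕ) (e : ℂ) (ω : ℂ × ℂ → (ℂ × ℂ →L[ℂ] ℂ))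
    (z : ℂ × ℂ) : z.1 * pullback (monomialMap a b p q e) ω z (1, 0) =
      a * ((monomialMap a b p q e z).1 * ω (monomialMap a b p q e z) (1, 0)) +
      b * ((monomialMap a b p q e z).2 * ω (monomialMap a b p q e z) (0, 1)) := by
  rw [pullback, (hasFDerivAt_monomialMap a b p q e z).fderiv, ContinuousLinearMap.comp_apply,
    clm_apply_eq]
  generalize ω (monomialMap a b p q e z) (1, 0) = A
  generalize ω (monomialMap a b p q e z) (0, 1) = B
  simp only [monomialMap, ContinuousLinearMap.prod_apply, add_apply,
    smul_apply, ContinuousLinearMap.coe_fst', ContinuousLinearMap.coe_snd',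
    smul_eq_mul, mul_zero, mul_one, zero_add]
  linear_combination (z.2 + e) ^ p * A * mul_natCast_mul_pow_pred z.1 a +
    (z.2 + e) ^ q * B * mul_natCast_mul_pow_pred z.1 b

theorem snd_mul_pullback_monomialMap (a b p q : ℕ) (e : ℂ) (ω : ℂ × ℂ → (ℂ × ℂ →L[ℂ] ℂ))
    (z : ℂ × ℂ) : (z.2 + e) * pullback (monomialMap a b p q e) ω z (0, 1) =
      p * ((monomialMap a b p q e z).1 * ω (monomialMap a b p q e z) (1, 0)) +
      q * ((monomialMap a b p q e z).2 * ω (monomialMap a b p q e z) (0, 1)) := by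
  rw [pullback, (hasFDerivAt_monomialMap a b p q e z).fderiv, ContinuousLinearMap.comp_apply,
    clm_apply_eq]
  generalize ω (monomialMap a b p q e z) (1, 0) = A
  generalize ω (monomialMap a b p q e z) (0, 1) = B
  simp only [monomialMap, ContinuousLinearMap.prod_apply, add_apply,
    smul_apply, ContinuousLinearMap.coe_fst', ContinuousLinearMap.coe_snd',
    smul_eq_mul, mul_zero, mul_one, add_zero]
  linear_combination z.1 ^ a * A * mul_natCast_mul_pow_pred (z.2 + e) p +
    z.1 ^ b * B * mul_natCast_mul_pow_pred (z.2 + e) q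

theorem pullback_comp {F G : ℂ × ℂ → ℂ × ℂ} (ω : ℂ × ℂ → (ℂ × ℂ →L[ℂ] ℂ)) {z : ℂ × ℂ}
    (hF : DifferentiableAt ℂ F (G z)) (hG : DifferentiableAt ℂ G z) :
    pullback (F ∘ G) ω z = pullback G (pullback F ω) z := by
  simp only [pullback]
  rw [fderiv_comp z hF hG]
  rfl

theorem monomialMap_zero {a b : ℕ} (ha : 0 < a) (hb : 0 < b) (p q : ℕ) (e : ℂ) :
    monomialMap a b p q e 0 = 0 := by
  simp [monomialMap, ha.ne', hb.ne']

theorem analyticAt_monomialMap (a b p q : ℕ) (e : ℂ) (z : ℂ × ℂ) :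
    AnalyticAt ℂ (monomialMap a b p q e) z :=
  ((analyticAt_fst.pow a).mul ((analyticAt_snd.add analyticAt_const).pow p)).prod
    ((analyticAt_fst.pow b).mul ((analyticAt_snd.add analyticAt_const).pow q))

/-- The logarithmic coefficients of a form of weight `d` are divisible by `u ^ d`. -/
theorem exists_log_coefficients {n m d : ℕ} (hn : 0 < n) (hm : 0 < m) (p q : ℕ) (e : ℂ)
    {v : Forms} (hv : v ∈ weightSubmodule n m d) :
    ∃ α β : ℂ × ℂ → ℂ, AnalyticAt ℂ α 0 ∧ AnalyticAt ℂ β 0 ∧ ∀ z,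
      (monomialMap n m p q e z).1 * v.1.1 (monomialMap n m p q e z) = z.1 ^ d * α z ∧
      (monomialMap n m p q e z).2 * v.2.1 (monomialMap n m p q e z) = z.1 ^ d * β z := by
  have hmon : ∀ i j k, AnalyticAt ℂ (fun z : ℂ × ℂ => z.1 ^ i * (z.2 + e) ^ (j + k)) 0 :=
    fun i j k => (analyticAt_fst.pow _).mul ((analyticAt_snd.add analyticAt_const).pow _)
  refine weightSubmodule_induction (p := fun v => ∃ α β : ℂ × ℂ → ℂ, AnalyticAt ℂ α 0 ∧
    AnalyticAt ℂ β 0 ∧ ∀ z,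
      (monomialMap n m p q e z).1 * v.1.1 (monomialMap n m p q e z) = z.1 ^ d * α z ∧
      (monomialMap n m p q e z).2 * v.2.1 (monomialMap n m p q e z) = z.1 ^ d * β z)
    (fun a b h => ?_) (fun a b h => ?_) ?_ ?_ ?_ hv
  · obtain ⟨r, hr⟩ := Nat.exists_eq_add_of_le h
    refine ⟨_, 0, hmon r (p * (a + 1)) (q * b), analyticAt_const, fun z => ⟨?_, ?_⟩⟩
    · change (monomialMap n m p q e z).1 * ((monomialMap n m p q e z).1 ^ a *
        (monomialMap n m p q e z).2 ^ b) = _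
      simp only [monomialMap]
      rw [← mul_assoc (z.1 ^ d), ← pow_add, ← hr]
      ring
    · change _ * (0 : ℂ) = _ * (0 : ℂ)
      simp
  · obtain ⟨r, hr⟩ := Nat.exists_eq_add_of_le h
    refine ⟨0, _, analyticAt_const, hmon r (p * a) (q * (b + 1)), fun z => ⟨?_, ?_⟩⟩
    · change _ * (0 : ℂ) = _ * (0 : ℂ)
      simp
    · change (monomialMap n m p q e z).2 * ((monomialMap n m p q e z).1 ^ a *
        (monomialMap n m p q e z).2 ^ b) = _
      simp only [monomialMap]
      rw [← mul_assoc (z.1 ^ d), ← pow_add, ← hr]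
      ring
  · refine ⟨0, 0, analyticAt_const, analyticAt_const, fun z => ⟨?_, ?_⟩⟩ <;>
    · change _ * (0 : ℂ) = _ * (0 : ℂ)
      simp
  · rintro v w ⟨α, β, hα, hβ, h⟩ ⟨α', β', hα', hβ', h'⟩
    refine ⟨α + α', β + β', hα.add hα', hβ.add hβ', fun z => ⟨?_, ?_⟩⟩
    · change _ * (v.1.1 _ + w.1.1 _) = _ * (α z + α' z)
      rw [mul_add, mul_add, (h z).1, (h' z).1]
    · change _ * (v.2.1 _ + w.2.1 _) = _ * (β z + β' z)
      rw [mul_add, mul_add, (h z).2, (h' z).2]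
  · rintro f v ⟨α, β, hα, hβ, h⟩
    have hf : AnalyticAt ℂ (fun z => f.1 (monomialMap n m p q e z)) 0 :=
      AnalyticAt.comp_of_eq f.2 (analyticAt_monomialMap n m p q e 0)
        (monomialMap_zero hn hm p q e)
    refine ⟨_, _, hf.mul hα, hf.mul hβ, fun z => ⟨?_, ?_⟩⟩
    · change _ * (f.1 _ * v.1.1 _) = _ * (f.1 _ * α z)
      rw [mul_left_comm, (h z).1, mul_left_comm]
    · change _ * (f.1 _ * v.2.1 _) = _ * (f.1 _ * β z)
      rw [mul_left_comm, (h z).2, mul_left_comm]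

/-- A monomial in `(u, v + e)` of degree `d` in `u` is not divisible by `u ^ (d + 1)`. -/
theorem not_eventually_pow_succ_dvd {d k : ℕ} {e c : ℂ} (hc : c ≠ 0) {g : ℂ × ℂ → ℂ}
    (hg : AnalyticAt ℂ g 0) :
    ¬ ∀ᶠ z in 𝓝 (0 : ℂ × ℂ), c * (z.1 ^ d * (z.2 + e) ^ k) = z.1 ^ (d + 1) * g z := by
  intro h
  have h1 := (h.eventually_nhds.and hg.eventually_analyticAt)
  have hax : Tendsto (fun t : ℂ => ((0, t) : ℂ × ℂ)) (𝓝 0) (𝓝 0) := by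
    have : Continuous fun t : ℂ => ((0, t) : ℂ × ℂ) := by fun_prop
    exact this.tendsto 0
  have hne : ∀ᶠ t in 𝓝[≠] (0 : ℂ), t + e ≠ 0 := by
    by_cases he : e = 0
    · filter_upwards [self_mem_nhdsWithin] with t ht
      simpa [he] using ht
    · have : ∀ᶠ t in 𝓝 (0 : ℂ), t + e ≠ 0 :=
        ContinuousAt.eventually_ne (by fun_prop) (by simpa using he)
      exact this.filter_mono nhdsWithin_le_nhds
  -- Fix v = t with t + e ≠ 0 and let u → 0: after division by u^d, the left side is a nonzero
  -- constant and the right side tends to 0.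
  obtain ⟨t, ⟨ht1, ht2⟩, ht3⟩ :=
    ((hax.eventually h1).filter_mono nhdsWithin_le_nhds |>.and hne).exists
  have hray : Tendsto (fun u : ℂ => ((u, t) : ℂ × ℂ)) (𝓝 0) (𝓝 (0, t)) := by
    have : Continuous fun u : ℂ => ((u, t) : ℂ × ℂ) := by fun_prop
    exact this.tendsto 0
  have hlim1 : Tendsto (fun u : ℂ => u * g (u, t)) (𝓝[≠] 0) (𝓝 0) := by
    have : Tendsto (fun u : ℂ => u * g (u, t)) (𝓝 0) (𝓝 (0 * g (0, t))) :=
      tendsto_id.mul (ht2.continuousAt.tendsto.comp hray)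
    rw [zero_mul] at this
    exact this.mono_left nhdsWithin_le_nhds
  have heq : (fun u : ℂ => u * g (u, t)) =ᶠ[𝓝[≠] 0] fun _ => c * (t + e) ^ k := by
    filter_upwards [(hray.eventually ht1).filter_mono nhdsWithin_le_nhds, self_mem_nhdsWithin]
      with u hu hu0
    have hu0 : u ^ d ≠ 0 := pow_ne_zero d hu0
    apply mul_left_cancel₀ hu0
    linear_combination -hu
  have := tendsto_nhds_unique (hlim1.congr' heq) tendsto_const_nhds
  exact mul_ne_zero hc (pow_ne_zero k ht3) this.symm

end

end CuspGeom

namespace CuspGeom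

noncomputable section

/-! ### Forms in adapted coordinates -/

theorem analyticAt_pullback_apply {F : ℂ × ℂ → ℂ × ℂ} (hF : AnalyticAt ℂ F 0) (h0 : F 0 = 0)
    {ω : ℂ × ℂ → (ℂ × ℂ →L[ℂ] ℂ)} (hω : AnalyticAt ℂ ω 0) (h : ℂ × ℂ) :
    AnalyticAt ℂ (fun z => pullback F ω z h) 0 := by
  have h1 : ∀ k : ℂ × ℂ, AnalyticAt ℂ (fun z => ω (F z) k) 0 := fun k =>
    ((ContinuousLinearMap.apply ℂ ℂ k).analyticAt _).comp (hω.comp_of_eq hF h0)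
  have h2 : AnalyticAt ℂ (fun z => fderiv ℂ F z h) 0 :=
    ((ContinuousLinearMap.apply ℂ (ℂ × ℂ) h).analyticAt _).comp hF.fderiv
  have h3 : (fun z => pullback F ω z h) = fun z =>
      (fderiv ℂ F z h).1 * ω (F z) (1, 0) + (fderiv ℂ F z h).2 * ω (F z) (0, 1) := by
    funext z
    rw [pullback, ContinuousLinearMap.comp_apply, clm_apply_eq]
  rw [h3]
  exact ((analyticAt_fst.comp h2).mul (h1 _)).add ((analyticAt_snd.comp h2).mul (h1 _))

/-- The coefficients of the pull-back of a `1`-form. -/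
def pullbackForms {F : ℂ × ℂ → ℂ × ℂ} (hF : AnalyticAt ℂ F 0) (h0 : F 0 = 0) (ω : OneForm) :
    Forms :=
  (⟨fun z => pullback F ω.1 z (1, 0), analyticAt_pullback_apply hF h0 ω.2 _⟩,
    ⟨fun z => pullback F ω.1 z (0, 1), analyticAt_pullback_apply hF h0 ω.2 _⟩)

/-- The `1`-form with given coefficients. -/
def toOneForm (v : Forms) : OneForm :=
  ⟨fun z => v.1.1 z • ContinuousLinearMap.fst ℂ ℂ ℂ + v.2.1 z • ContinuousLinearMap.snd ℂ ℂ ℂ,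
    (v.1.2.smul analyticAt_const).add (v.2.2.smul analyticAt_const)⟩

theorem toOneForm_pullbackForms {F : ℂ × ℂ → ℂ × ℂ} (hF : AnalyticAt ℂ F 0) (h0 : F 0 = 0)
    (ω : OneForm) : (toOneForm (pullbackForms hF h0 ω)).1 = pullback F ω.1 := by
  funext z
  ext <;> simp [toOneForm, pullbackForms]

/-- Every form is the pull-back of a form by an automorphism. -/
theorem exists_pullbackForms_eq {Φ Ψ : ℂ × ℂ → ℂ × ℂ} (hΦ : ∀ z, AnalyticAt ℂ Φ z)
    (hΨ : ∀ z, AnalyticAt ℂ Ψ z) (hinv : ∀ z, Ψ (Φ z) = z) (h0 : Φ 0 = 0) (v : Forms) :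
    ∃ ω : OneForm, pullbackForms (hΦ 0) h0 ω = v := by
  have hΨ0 : Ψ 0 = 0 := by rw [← h0, hinv, h0]
  refine ⟨toOneForm (pullbackForms (hΨ 0) hΨ0 (toOneForm v)), ?_⟩
  have h1 : ∀ z, pullback Φ (pullback Ψ (toOneForm v).1) z = (toOneForm v).1 z := by
    intro z
    rw [← pullback_comp _ (hΨ _).differentiableAt (hΦ z).differentiableAt,
      show Ψ ∘ Φ = id from funext hinv]
    simp [pullback]
  ext1 <;> ext z
  · change pullback Φ (toOneForm (pullbackForms (hΨ 0) hΨ0 (toOneForm v))).1 z (1, 0) = _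
    rw [toOneForm_pullbackForms, h1]
    simp [toOneForm]
  · change pullback Φ (toOneForm (pullbackForms (hΨ 0) hΨ0 (toOneForm v))).1 z (0, 1) = _
    rw [toOneForm_pullbackForms, h1]
    simp [toOneForm]

/-- The parametrization is Φ ∘ γ with γ = Ψ ∘ `C.param`, so restricting ω to C is restricting its
pull-back by Φ to γ. -/
theorem diffValue_eq (C : Branch) {Φ Ψ : ℂ × ℂ → ℂ × ℂ} (hΦ : ∀ z, AnalyticAt ℂ Φ z)
    (hΨ : ∀ z, AnalyticAt ℂ Ψ z) (hinv : ∀ z, Φ (Ψ z) = z) (h0 : Φ 0 = 0) (ω : OneForm) :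
    C.diffValue ω = analyticOrderAt (evalForm (fun t => (Ψ (C.param t)).1)
      (fun t => (Ψ (C.param t)).2) (pullbackForms (hΦ 0) h0 ω)) 0 := by
  refine analyticOrderAt_congr ?_
  filter_upwards [C.analytic.eventually_analyticAt] with t ht
  let γ : ℂ → ℂ × ℂ := fun t => Ψ (C.param t)
  have hγ : HasDerivAt γ (deriv γ t) t :=
    ((hΨ (C.param t)).comp ht).differentiableAt.hasDerivAt
  have h1 : deriv (fun t => (γ t).1) t = (deriv γ t).1 :=
    ((hasFDerivAt_fst (𝕜 := ℂ) (p := γ t)).comp_hasDerivAt t hγ).deriv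
  have h2 : deriv (fun t => (γ t).2) t = (deriv γ t).2 :=
    ((hasFDerivAt_snd (𝕜 := ℂ) (p := γ t)).comp_hasDerivAt t hγ).deriv
  have h3 : deriv C.param t = fderiv ℂ Φ (γ t) (deriv γ t) := by
    have h4 : C.param = Φ ∘ γ := funext fun t => (hinv _).symm
    have h5 := ((hΦ (γ t)).differentiableAt.hasFDerivAt.comp_hasDerivAt t hγ).deriv
    rwa [← h4] at h5
  change t * ω.1 (C.param t) (deriv C.param t) = t * (pullback Φ ω.1 (γ t) (1, 0) *
    deriv (fun t => (γ t).1) t + pullback Φ ω.1 (γ t) (0, 1) * deriv (fun t => (γ t).2) t)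
  have h6 : ω.1 (C.param t) (deriv C.param t) = pullback Φ ω.1 (γ t) (deriv γ t) := by
    rw [h3, pullback, hinv]
    rfl
  rw [h6, clm_apply_eq, h1, h2]
  ring

/-- Along the lift, u has order 1 by transversality and v + e is a unit because Q is free; the
monomial map then gives orders n and m. -/
theorem isCurve_of_isCusp {S : CuspidalSequence} {C : Branch} (hC : C.IsCusp S) {n m : ℕ}
    (hn : 0 < n) (hm : 0 < m) {Φ Ψ : ℂ × ℂ → ℂ × ℂ} (hΨ : ∀ z, AnalyticAt ℂ Ψ z)
    (hinv : ∀ z, Ψ (Φ z) = z)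
    (hQ : ∀ Q, ∃ p q e, (S.IsFree Q ↔ e ≠ 0) ∧ (n * q = m * p + 1 ∨ n * q + 1 = m * p) ∧
        S.proj Q = Φ ∘ monomialMap n m p q e) :
    IsCurve (fun t => (Ψ (C.param t)).1) (fun t => (Ψ (C.param t)).2) n m := by
  obtain ⟨Q, hfree, ψ, hψ, hψ0, hψ', hpar⟩ := hC
  obtain ⟨p, q, e, he, -, hproj⟩ := hQ Q
  have he0 := he.1 hfree
  have hγ : AnalyticAt ℂ (fun t => Ψ (C.param t)) 0 := (hΨ _).comp C.analytic
  have hψ1 : AnalyticAt ℂ (fun t => (ψ t).1) 0 := analyticAt_fst.comp hψ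
  have hψ2 : AnalyticAt ℂ (fun t => (ψ t).2 + e) 0 :=
    (analyticAt_snd.comp hψ).add analyticAt_const
  have ho1 : analyticOrderAt (fun t => (ψ t).1) 0 = 1 := by
    refine hψ1.analyticOrderAt_eq_one_of_zero_deriv_ne_zero (by rw [hψ0]; rfl) ?_
    have h1 : deriv (fun t => (ψ t).1) 0 = (deriv ψ 0).1 :=
      ((hasFDerivAt_fst (𝕜 := ℂ) (p := ψ 0)).comp_hasDerivAt 0
        hψ.differentiableAt.hasDerivAt).deriv
    rwa [h1]
  have ho2 : analyticOrderAt (fun t => (ψ t).2 + e) 0 = 0 := by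
    rw [hψ2.analyticOrderAt_eq_zero, hψ0]
    simpa using he0
  have hord : ∀ a b : ℕ, analyticOrderAt
      ((fun t => (ψ t).1) ^ a * (fun t => (ψ t).2 + e) ^ b) 0 = a := fun a b => by
    rw [analyticOrderAt_mul (hψ1.pow a) (hψ2.pow b), analyticOrderAt_pow hψ1,
      analyticOrderAt_pow hψ2, ho1, ho2]
    simp
  have hmon : ∀ᶠ t in 𝓝 (0 : ℂ), Ψ (C.param t) = monomialMap n m p q e (ψ t) := by
    filter_upwards [hpar] with t ht
    rw [ht, hproj, Function.comp_apply, hinv]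
  refine ⟨hn, hm, analyticAt_fst.comp hγ, analyticAt_snd.comp hγ, ?_, ?_⟩
  · rw [← hord n p]
    refine analyticOrderAt_congr ?_
    filter_upwards [hmon] with t ht
    rw [ht]
    rfl
  · rw [← hord m q]
    refine analyticOrderAt_congr ?_
    filter_upwards [hmon] with t ht
    rw [ht]
    rfl

/-- A form whose initial form is `x ^ A y ^ B (m dx / x - n dy / y)` has divisorial order
`n A + m B`. -/
theorem hasDivOrder_of_initial (S : CuspidalSequence) {n m : ℕ} (hn : 0 < n) (hm : 0 < m)
    {Φ : ℂ × ℂ → ℂ × ℂ} (hΦ : ∀ z, AnalyticAt ℂ Φ z) (h0 : Φ 0 = 0)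
    (hQ : ∀ Q, ∃ p q e, (S.IsFree Q ↔ e ≠ 0) ∧ (n * q = m * p + 1 ∨ n * q + 1 = m * p) ∧
        S.proj Q = Φ ∘ monomialMap n m p q e) {ω : OneForm} {a b d : ℕ}
    (hd : d = n * (a + 1) + m * (b + 1))
    (hω : pullbackForms (hΦ 0) h0 ω - (coordX ^ a * coordY ^ b) • eulerForm n m ∈
      weightSubmodule n m (d + 1)) : S.HasDivOrder ω d := by
  intro Q
  obtain ⟨p, q, e, he, hdet, hproj⟩ := hQ Q
  set μ := monomialMap n m p q e with hμ
  set v := pullbackForms (hΦ 0) h0 ω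
  have hpb : ∀ z, pullback (S.proj Q) ω.1 z = pullback μ (pullback Φ ω.1) z := fun z => by
    rw [hproj]
    exact pullback_comp _ (hΦ _).differentiableAt
      (analyticAt_monomialMap _ _ _ _ _ _).differentiableAt
  have hfst : ∀ z, z.1 * pullback (S.proj Q) ω.1 z (1, 0) =
      n * ((μ z).1 * v.1.1 (μ z)) + m * ((μ z).2 * v.2.1 (μ z)) := fun z => by
    rw [hpb]
    exact fst_mul_pullback_monomialMap n m p q e _ z
  have hsnd : ∀ z, (z.2 + e) * pullback (S.proj Q) ω.1 z (0, 1) =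
      p * ((μ z).1 * v.1.1 (μ z)) + q * ((μ z).2 * v.2.1 (μ z)) := fun z => by
    rw [hpb]
    exact snd_mul_pullback_monomialMap n m p q e _ z
  have hEuler : (coordX ^ a * coordY ^ b) • eulerForm n m ∈ weightSubmodule n m d := by
    rw [monomial_smul_eulerForm]
    have h1 : (m : ℂ) • monoDx a (b + 1) ∈ (weightSubmodule n m d).restrictScalars ℂ :=
      Submodule.smul_mem _ _ (monoDx_mem hd.le)
    have h2 : (n : ℂ) • monoDy (a + 1) b ∈ (weightSubmodule n m d).restrictScalars ℂ :=
      Submodule.smul_mem _ _ (monoDy_mem hd.le)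
    exact Submodule.sub_mem _ h1 h2
  have hvd : v ∈ weightSubmodule n m d := by
    have := Submodule.add_mem _ (weightSubmodule_anti n m (Nat.le_succ d) hω) hEuler
    rwa [sub_add_cancel] at this
  apply le_antisymm
  · refine iSup₂_le fun l hl => ?_
    by_contra! hlt
    have hlt : d < l := by exact_mod_cast hlt
    obtain ⟨r, rfl⟩ := Nat.exists_eq_add_of_lt hlt
    obtain ⟨_, β', -, hβ', hev⟩ := hl
    -- The resonant form has no du/u component (nm − mn = 0), so only the dv coefficient bounds the
    -- order. Multiplying it by v + e treats free points and corners alike.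
    obtain ⟨g, hg, hge⟩ : ∃ g : ℂ × ℂ → ℂ, AnalyticAt ℂ g 0 ∧ ∀ᶠ z in 𝓝 (0 : ℂ × ℂ),
        (z.2 + e) * pullback (S.proj Q) ω.1 z (0, 1) = z.1 ^ (d + 1) * g z := by
      by_cases hfree : S.IsFree Q
      · refine ⟨fun z => (z.2 + e) * (z.1 ^ r * β' z), (analyticAt_snd.add analyticAt_const).mul
          ((analyticAt_fst.pow r).mul hβ'), ?_⟩
        filter_upwards [hev] with z hz
        rw [hz.2.1 hfree]
        ring
      · have he0 : e = 0 := not_not.1 fun h => hfree (he.2 h)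
        refine ⟨fun z => z.1 ^ r * β' z, (analyticAt_fst.pow r).mul hβ', ?_⟩
        filter_upwards [hev] with z hz
        rw [he0, add_zero, hz.2.2 hfree]
        ring
    obtain ⟨α, β, hα, hβ, hαβ⟩ := exists_log_coefficients hn hm p q e hω
    -- This number, ±1 by the determinant condition, is the coefficient of dv/(v+e) in the
    -- pulled-back resonant form.
    have hc : (p * m - q * n : ℂ) ≠ 0 := by
      intro h
      have h2 : p * m = q * n := by exact_mod_cast sub_eq_zero.1 h
      rcases hdet with h3 | h3 <;> nlinarith
    refine not_eventually_pow_succ_dvd (d := d) (k := p * (a + 1) + q * (b + 1)) (e := e) hc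
      (g := fun z => g z - (p * α z + q * β z))
      (hg.sub ((analyticAt_const.mul hα).add (analyticAt_const.mul hβ))) ?_
    filter_upwards [hge] with z hz
    have h1 : (μ z).1 * (v.1.1 (μ z) - m * ((μ z).1 ^ a * (μ z).2 ^ (b + 1))) =
        z.1 ^ (d + 1) * α z := by
      rw [← (hαβ z).1, monomial_smul_eulerForm]
      change _ = _ * (v.1.1 (μ z) - (m * ((μ z).1 ^ a * (μ z).2 ^ (b + 1)) - n * 0))
      ring
    have h2 : (μ z).2 * (v.2.1 (μ z) + n * ((μ z).1 ^ (a + 1) * (μ z).2 ^ b)) =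
        z.1 ^ (d + 1) * β z := by
      rw [← (hαβ z).2, monomial_smul_eulerForm]
      change _ = _ * (v.2.1 (μ z) - (m * 0 - n * ((μ z).1 ^ (a + 1) * (μ z).2 ^ b)))
      ring
    have h3 : (μ z).1 ^ (a + 1) * (μ z).2 ^ (b + 1) =
        z.1 ^ d * (z.2 + e) ^ (p * (a + 1) + q * (b + 1)) := by
      rw [hμ, monomialMap, hd]
      ring
    rw [hsnd] at hz
    rw [← h3]
    linear_combination hz - p * h1 - q * h2
  · refine le_iSup₂_of_le d ?_ le_rfl
    obtain ⟨α, β, hα, hβ, hαβ⟩ := exists_log_coefficients hn hm p q e hvd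
    have hnum : AnalyticAt ℂ (fun z => p * α z + q * β z) 0 :=
      (analyticAt_const.mul hα).add (analyticAt_const.mul hβ)
    have hnum' : AnalyticAt ℂ (fun z => n * α z + m * β z) 0 :=
      (analyticAt_const.mul hα).add (analyticAt_const.mul hβ)
    have h1 : ∀ z, z.1 * pullback (S.proj Q) ω.1 z (1, 0) = z.1 ^ d * (n * α z + m * β z) :=
      fun z => by
        rw [hfst, (hαβ z).1, (hαβ z).2]
        ring
    have h2 : ∀ z, (z.2 + e) * pullback (S.proj Q) ω.1 z (0, 1) =
        z.1 ^ d * (p * α z + q * β z) := fun z => by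
      rw [hsnd, (hαβ z).1, (hαβ z).2]
      ring
    by_cases hfree : S.IsFree Q
    · have hden : AnalyticAt ℂ (fun z : ℂ × ℂ => z.2 + e) 0 := analyticAt_snd.add analyticAt_const
      have hden0 : (0 : ℂ × ℂ).2 + e ≠ 0 := by simpa using he.1 hfree
      refine ⟨_, _, hnum', hnum.div hden hden0, ?_⟩
      filter_upwards [hden.continuousAt.eventually_ne hden0] with z hz
      refine ⟨h1 z, fun _ => ?_, fun h => absurd hfree h⟩
      rw [Pi.div_apply]
      field_simp
      linear_combination h2 z
    · have he0 : e = 0 := not_not.1 fun h => hfree (he.2 h)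
      refine ⟨_, _, hnum', hnum, .of_forall fun z => ⟨h1 z, fun h => absurd h hfree, fun _ => ?_⟩⟩
      have := h2 z
      rwa [he0, add_zero] at this

end

end CuspGeom

/-! ### Transfer to the germ through the adapted coordinates. -/

theorem mainTheorem4 (S : CuspGeom.CuspidalSequence) (n m : ℕ)
    (hS : S.puiseuxPair = (n, m)) (hn : 2 ≤ n)
    (C : CuspGeom.Branch) (hC : C.IsCusp S) :
    (∃ (s : ℕ) (lam : ℕ → ℕ), CuspGeom.IsBasis n m C.diffValues s lam) ∧
    ∀ (s : ℕ) (lam : ℕ → ℕ), CuspGeom.IsBasis n m C.diffValues s lam →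
      (∃ ω : CuspGeom.OneForm, CuspGeom.IsDicriticallyAdjusted S C n m s lam ω) ∧
      ∀ W : ℕ → CuspGeom.OneForm, CuspGeom.IsStandardBasis C s lam W →
        ∃ W' : ℕ → CuspGeom.OneForm, (∀ i < s + 2, W' i = W i) ∧
          CuspGeom.IsExtendedStandardBasis S C n m s lam W' := by
  obtain ⟨hco, hnm, Φ, Ψ, hΦ, hΨ, hΦΨ, hΨΦ, h0, hQ⟩ := S.exists_coordinates hS hn
  have hc := CuspGeom.isCurve_of_isCusp hC (by omega) (by omega) hΨ hΨΦ hQ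
  have hval := CuspGeom.diffValue_eq C hΦ hΨ hΦΨ h0
  have hvalues : C.diffValues = (hc.model hco hnm.le).values := by
    ext k
    constructor
    · rintro ⟨ω, hω⟩
      exact ⟨CuspGeom.pullbackForms (hΦ 0) h0 ω, (hval ω).symm.trans hω⟩
    · rintro ⟨v, hv⟩
      obtain ⟨ω, rfl⟩ := CuspGeom.exists_pullbackForms_eq hΦ hΨ hΨΦ h0 v
      exact ⟨ω, (hval ω).trans hv⟩
  rw [hvalues]
  refine ⟨(hc.model hco hnm.le).exists_basis hco hn, fun s lam hbasis => ?_⟩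
  have hadj : ∃ ω : CuspGeom.OneForm, CuspGeom.IsDicriticallyAdjusted S C n m s lam ω := by
    obtain ⟨A, B, η, hcrit, htop, hA, hB, hin⟩ :=
      (hc.model hco hnm.le).exists_dicritical hco hn hnm hbasis
    obtain ⟨ω, rfl⟩ := CuspGeom.exists_pullbackForms_eq hΦ hΨ hΨΦ h0 η
    refine ⟨ω, ?_, (hval ω).trans htop⟩
    rw [hcrit]
    refine CuspGeom.hasDivOrder_of_initial S (by omega) (by omega) hΦ h0 hQ
      (a := A - 1) (b := B - 1) (by rw [Nat.sub_add_cancel hA, Nat.sub_add_cancel hB]) ?_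
    rw [one_smul] at hin
    exact hin
  refine ⟨hadj, fun W hW => ?_⟩
  obtain ⟨ω, hω⟩ := hadj
  -- A standard basis constrains only the indices below s + 2, so the adjusted form may replace the
  -- entry at s + 2.
  have hne : ∀ i < s + 2, Function.update W (s + 2) ω i = W i := fun i hi =>
    Function.update_of_ne hi.ne _ _
  refine ⟨Function.update W (s + 2) ω, hne, fun i hi => ?_, ?_⟩
  · rw [hne i hi]
    exact hW i hi
  · rwa [Function.update_self]
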